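/- Let $b,c>0$ and let $V\in L^1_{\mathrm{loc}}(\mathbb R)$ be real-valued with $$\lim_{|x|\to\infty}\int_x^{x+1}|V(s)|\,ds=0 .$$ Notation. Put $D=-\mathrm i\,\frac{d}{dx}$. For $a>0$ let $|D|^a$ be the Fourier multiplier $u\mapsto\mathcal F^{-1}(|\lambda|^a\hat u)$, where $\hat u(\lambda)=(2\pi)^{-1/2}\int_{\mathbb R}e^{-\mathrm i\lambda x}u(x)\,dx$. Let $\dot H^{1/2}(\mathbb R)$ be the completion of $H^{1/2}(\mathbb R)=\{u\in L^2(\mathbb R): |D|^{1/2}u\in L^2(\mathbb R)\}$ with respect to the norm $\|u\|_{\dot H^{1/2}}=\||D|^{1/2}u\|_{L^2}$. Let $\mathcal J$ be the bounded operator on $\dot H^{1/2}(\mathbb R)$ that extends $u\mapsto\mathcal F^{-1}(\operatorname{sgn}(\lambda)\,\hat u)$ from $H^{1/2}(\mathbb R)$ by continuity. Let $H_V$ be the maximal operator in $L^2(\mathbb R)$ associated with $\tau_V=-c^2\frac{d^2}{dx^2}+b^2+V$: its domain consists of all $u\in L^2(\mathbb R)$ such that $u,u'$ are locally absolutely continuous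 and $\tau_Vu\in L^2(\mathbb R)$, and $H_Vu=\tau_Vu$. Let $$\mathfrak t_V[u,v]=c^2\int_{\mathbb R}u'\,\overline{v'}\,dx+b^2\int_{\mathbb R}u\,\overline v\,dx+\int_{\mathbb R}V\,u\,\overline v\,dx,\qquad u,v\in H^1(\mathbb R).$$ Let $\mathcal L$ be the self-adjoint operator in $\dot H^{1/2}(\mathbb R)$ associated with $\mathfrak t_V$: $u\in\operatorname{dom}(\mathcal L)$ and $\mathcal Lu=w$ if and only if $u\in H^1(\mathbb R)$, $w\in\dot H^{1/2}(\mathbb R)$ and $\mathfrak t_V[u,v]=(w,v)_{\dot H^{1/2}}$ for all $v\in H^1(\mathbb R)$. Put $\mathcal A=\mathcal J\mathcal L$ with $\operatorname{dom}(\mathcal A)=\operatorname{dom}(\mathcal L)$. For $z\in\mathbb C$ put $\ker(D^{-1}H_V-z):=\ker(H_V-zD)=\{u\in\operatorname{dom}(H_V):H_Vu=zDu\}$ and, for $n\ge1$, $$\ker\big((D^{-1}H_V-z)^{n+1}\big):=\big\{u\in\operatorname{dom}(H_V):\ H_Vu-zDu\in D\big(\ker((D^{-1}H_V-z)^n)\big)\big\}.$$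 For $n=0$ the spaces $\ker((D^{-1}H_V-z)^n)$ and $\ker((\mathcal A-z)^n)$ are $\{0\}$. Put $\mathrm E_z(A)=\bigcup_{n}\ker((D^{-1}H_V-z)^n)$ and $\mathrm E_z(\mathcal A)=\bigcup_{n}\ker((\mathcal A-z)^n)$. A subset of $L^2(\mathbb R)$ and a subset of $\dot H^{1/2}(\mathbb R)$ are said to be equal if they are the same set of elements of $H^{1/2}(\mathbb R)$, which is included in both spaces. Lemma. For every $z\in\mathbb C$ and every $n\in\mathbb N$, $$\ker(H_V-zD)=\ker(\mathcal L-z\mathcal J),\qquad \ker\big((D^{-1}H_V-z)^n\big)=\ker\big((\mathcal A-z)^n\big),\qquad \mathrm E_z(A)=\mathrm E_z(\mathcal A).$$ In particular, $\ker(H_V)=\ker(\mathcal L)$. -/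

import Mathlib

open MeasureTheory Filter Topology FourierTransform ComplexConjugate

noncomputable section

namespace HamKrein

/-! ### Partially defined operators: kernels and powers -/

section PMap

variable {E F G : Type*} [AddCommGroup E] [Module ℂ E] [AddCommGroup F] [Module ℂ F]
  [AddCommGroup G] [Module ℂ G]

/-- The kernel `{u ∈ dom T : T u = 0}` of a partially defined operator. -/
def pker (T : E →ₗ.[ℂ] F) : Submodule ℂ E :=
  (LinearMap.ker T.toFun).map T.domain.subtype

theorem mem_pker {T : E →ₗ.[ℂ] F} {u : E} :
    u ∈ pker T ↔ ∃ h : u ∈ T.domain, T ⟨u, h⟩ = 0 := by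
  simp [pker]

/-- The product `S T` of partially defined operators on its maximal domain
`{u ∈ dom T : T u ∈ dom S}`. -/
def pcomp (S : F →ₗ.[ℂ] G) (T : E →ₗ.[ℂ] F) : E →ₗ.[ℂ] G :=
  S.comp (T.domRestrict ((S.domain.comap T.toFun).map T.domain.subtype)) (by
    rintro ⟨x, hx, hx'⟩
    obtain ⟨y, hy, rfl⟩ := hx
    exact hy)

theorem mem_pcomp_domain {S : F →ₗ.[ℂ] G} {T : E →ₗ.[ℂ] F} {u : E} :
    u ∈ (pcomp S T).domain ↔ ∃ h : u ∈ T.domain, T ⟨u, h⟩ ∈ S.domain := by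
  constructor
  · rintro ⟨⟨y, hy, rfl⟩, h⟩
    exact ⟨h, hy⟩
  · rintro ⟨h, h'⟩
    exact ⟨⟨⟨u, h⟩, h', rfl⟩, h⟩

theorem pcomp_apply {S : F →ₗ.[ℂ] G} {T : E →ₗ.[ℂ] F} {u : E} (hu : u ∈ (pcomp S T).domain)
    (h : u ∈ T.domain) (h' : T ⟨u, h⟩ ∈ S.domain) :
    pcomp S T ⟨u, hu⟩ = S ⟨T ⟨u, h⟩, h'⟩ := rfl

/-- The powers `T ^ n` of a partially defined operator on their maximal domains:
`dom (T ^ (n + 1)) = {u ∈ dom T : T u ∈ dom (T ^ n)}`. -/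
def ppow (T : E →ₗ.[ℂ] E) : ℕ → (E →ₗ.[ℂ] E)
  | 0 => LinearMap.id.toPMap ⊤
  | n + 1 => pcomp (ppow T n) T

end PMap

/-! ### Fourier multipliers on `L²(ℝ)` -/

/-- The complex Hilbert space `L²(ℝ)`. -/
abbrev L2 : Type := Lp ℂ 2 (volume : Measure ℝ)

theorem mul_fourier_add (m : ℝ → ℂ) (u v : L2) :
    (fun ξ => m ξ * (𝓕 (u + v) : L2) ξ) =ᵐ[volume]
      (fun ξ => m ξ * (𝓕 u : L2) ξ) + fun ξ => m ξ * (𝓕 v : L2) ξ := by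
  rw [FourierTransform.fourier_add]
  filter_upwards [Lp.coeFn_add (𝓕 u : L2) (𝓕 v)] with ξ hξ
  rw [hξ, Pi.add_apply, Pi.add_apply, mul_add]

theorem mul_fourier_smul (m : ℝ → ℂ) (z : ℂ) (u : L2) :
    (fun ξ => m ξ * (𝓕 (z • u) : L2) ξ) =ᵐ[volume] z • fun ξ => m ξ * (𝓕 u : L2) ξ := by
  rw [FourierTransform.fourier_smul]
  filter_upwards [Lp.coeFn_smul z (𝓕 u : L2)] with ξ hξ
  rw [hξ, Pi.smul_apply, Pi.smul_apply, smul_eq_mul, smul_eq_mul]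
  ring

theorem fourier_zero_L2 : (𝓕 (0 : L2) : L2) = 0 := (Lp.fourierTransformₗᵢ ℝ ℂ).map_zero

/-- The maximal domain `{u ∈ L² : m · 𝓕 u ∈ L²}` of the Fourier multiplier with symbol `m`. Here
`𝓕` is Mathlib's Fourier transform, `𝓕 u ξ = ∫ exp (-2 π i x ξ) u x dx`. -/
def multDomain (m : ℝ → ℂ) : Submodule ℂ L2 where
  carrier := {u | MemLp (fun ξ => m ξ * (𝓕 u : L2) ξ) 2 volume}
  zero_mem' := by
    have h : (fun ξ => m ξ * (𝓕 (0 : L2) : L2) ξ) =ᵐ[volume] fun _ => (0 : ℂ) := by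
      rw [fourier_zero_L2]
      filter_upwards [Lp.coeFn_zero ℂ 2 (volume : Measure ℝ)] with ξ hξ
      rw [hξ]
      simp
    exact (memLp_congr_ae h).2 MemLp.zero
  add_mem' := fun hu hv => (memLp_congr_ae (mul_fourier_add m _ _)).2 (MemLp.add hu hv)
  smul_mem' := fun z _ hu => (memLp_congr_ae (mul_fourier_smul m z _)).2 (MemLp.const_smul hu z)

/-- The function `m · 𝓕 u ∈ L²(ℝ)`. -/
def mulFourier (m : ℝ → ℂ) (u : multDomain m) : L2 :=
  MemLp.toLp (fun ξ => m ξ * (𝓕 (u : L2) : L2) ξ) u.2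

theorem mulFourier_coe (m : ℝ → ℂ) (u : multDomain m) :
    mulFourier m u =ᵐ[volume] fun ξ => m ξ * (𝓕 (u : L2) : L2) ξ := MemLp.coeFn_toLp _

theorem mulFourier_add (m : ℝ → ℂ) (u v : multDomain m) :
    mulFourier m (u + v) = mulFourier m u + mulFourier m v :=
  Lp.ext <| (mulFourier_coe m (u + v)).trans <| (mul_fourier_add m u v).trans <|
    ((mulFourier_coe m u).add (mulFourier_coe m v)).symm.trans (Lp.coeFn_add _ _).symm

theorem mulFourier_smul (m : ℝ → ℂ) (z : ℂ) (u : multDomain m) :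
    mulFourier m (z • u) = z • mulFourier m u :=
  Lp.ext <| (mulFourier_coe m (z • u)).trans <| (mul_fourier_smul m z u).trans <|
    ((mulFourier_coe m u).const_smul z).symm.trans (Lp.coeFn_smul _ _).symm

/-- The Fourier multiplier `u ↦ 𝓕⁻¹ (m · 𝓕 u)` with symbol `m` on its maximal domain. -/
def fourierMult (m : ℝ → ℂ) : L2 →ₗ.[ℂ] L2 where
  domain := multDomain m
  toFun :=
    { toFun := fun u => 𝓕⁻ (mulFourier m u)
      map_add' := fun u v => by rw [mulFourier_add, FourierTransform.fourierInv_add]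
      map_smul' := fun z u => by
        rw [mulFourier_smul, FourierTransform.fourierInv_smul, RingHom.id_apply] }

theorem mem_fourierMult_domain {m : ℝ → ℂ} {u : L2} :
    u ∈ (fourierMult m).domain ↔ MemLp (fun ξ => m ξ * (𝓕 u : L2) ξ) 2 volume := Iff.rfl

theorem fourier_fourierMult (m : ℝ → ℂ) (u : (fourierMult m).domain) :
    (𝓕 (fourierMult m u) : L2) =ᵐ[volume] fun ξ => m ξ * (𝓕 (u : L2) : L2) ξ := by
  have h : (𝓕 (fourierMult m u) : L2) = mulFourier m u :=
    FourierTransform.fourier_fourierInv_eq _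
  rw [h]
  exact mulFourier_coe m u

/-- The operator `D = -i d/dx`, the Fourier multiplier with symbol `2 π ξ`. -/
def D : L2 →ₗ.[ℂ] L2 := fourierMult fun ξ => ((2 * Real.pi * ξ : ℝ) : ℂ)

/-- The operator `|D| ^ a`, the Fourier multiplier with symbol `|2 π ξ| ^ a`. -/
def absD (a : ℝ) : L2 →ₗ.[ℂ] L2 := fourierMult fun ξ => ((|2 * Real.pi * ξ| ^ a : ℝ) : ℂ)

/-- The Fourier multiplier with symbol `sgn`. -/
def sgnD : L2 →ₗ.[ℂ] L2 := fourierMult fun ξ => ((Real.sign ξ : ℝ) : ℂ)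

/-! ### The Sobolev spaces `H¹(ℝ)` and `H^{1/2}(ℝ)` and the space `Ḣ^{1/2}(ℝ)` -/

/-- The Sobolev space `H¹(ℝ) = {u ∈ L² : D u ∈ L²}`. -/
abbrev H1 : Submodule ℂ L2 := D.domain

/-- The vector space `H^{1/2}(ℝ) = {u ∈ L² : |D|^{1/2} u ∈ L²}`. -/
def HHalf : Type := ↥(absD (1 / 2)).domain

instance : AddCommGroup HHalf := inferInstanceAs (AddCommGroup ↥(absD (1 / 2)).domain)
instance : Module ℂ HHalf := inferInstanceAs (Module ℂ ↥(absD (1 / 2)).domain)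

/-- The inclusion of `H^{1/2}(ℝ)` into `L²(ℝ)`. -/
def toL2 : HHalf →ₗ[ℂ] L2 := (absD (1 / 2)).domain.subtype

/-- The map `|D|^{1/2} : H^{1/2}(ℝ) → L²(ℝ)`. -/
def sqrtAbsD : HHalf →ₗ[ℂ] L2 := (absD (1 / 2)).toFun

theorem toL2_injective : Function.Injective toL2 := Subtype.val_injective

theorem fourier_sqrtAbsD (u : HHalf) : (𝓕 (sqrtAbsD u) : L2) =ᵐ[volume]
    fun ξ => ((|2 * Real.pi * ξ| ^ (1 / 2 : ℝ) : ℝ) : ℂ) * (𝓕 (toL2 u) : L2) ξ :=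
  fourier_fourierMult _ u

theorem fourier_injective : Function.Injective fun u : L2 => (𝓕 u : L2) :=
  (Lp.fourierTransformₗᵢ ℝ ℂ).injective

theorem ae_ne_zero : ∀ᵐ ξ : ℝ, ξ ≠ 0 := by simp [ae_iff, measure_singleton]

theorem symbol_pos {ξ : ℝ} (h : ξ ≠ 0) : 0 < |2 * Real.pi * ξ| ^ (1 / 2 : ℝ) :=
  Real.rpow_pos_of_pos (abs_pos.2 (mul_ne_zero (by positivity) h)) _

theorem sqrtAbsD_injective : Function.Injective sqrtAbsD := by
  refine (injective_iff_map_eq_zero _).2 fun u hu => ?_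
  apply toL2_injective
  rw [map_zero]
  apply fourier_injective
  have h1 := fourier_sqrtAbsD u
  rw [hu, fourier_zero_L2] at h1
  change (𝓕 (toL2 u) : L2) = 𝓕 (0 : L2)
  rw [fourier_zero_L2]
  apply Lp.ext
  filter_upwards [h1, Lp.coeFn_zero ℂ 2 (volume : Measure ℝ), ae_ne_zero] with ξ h2 h3 h4
  rw [h3] at h2 ⊢
  have h5 := symbol_pos h4
  have h6 : ((|2 * Real.pi * ξ| ^ (1 / 2 : ℝ) : ℝ) : ℂ) ≠ 0 := by exact_mod_cast h5.ne'
  exact (mul_eq_zero.1 h2.symm).resolve_left h6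

/-- `H^{1/2}(ℝ)` carries the norm `‖u‖ = ‖|D|^{1/2} u‖_{L²}` of `Ḣ^{1/2}(ℝ)`. -/
instance : NormedAddCommGroup HHalf :=
  NormedAddCommGroup.induced HHalf L2 sqrtAbsD sqrtAbsD_injective

instance : InnerProductSpace ℂ HHalf := InnerProductSpace.induced sqrtAbsD

theorem inner_HHalf (u v : HHalf) : inner ℂ u v = inner ℂ (sqrtAbsD u) (sqrtAbsD v) := rfl

theorem norm_HHalf (u : HHalf) : ‖u‖ = ‖sqrtAbsD u‖ := rfl

/-- The Hilbert space `Ḣ^{1/2}(ℝ)`: the completion of `H^{1/2}(ℝ)` with respect to the norm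
`‖u‖ = ‖|D|^{1/2} u‖_{L²}`. -/
abbrev HDot : Type := UniformSpace.Completion HHalf

/-- The inclusion of `H^{1/2}(ℝ)` into `Ḣ^{1/2}(ℝ)`. -/
def toHDot : HHalf →ₗᵢ[ℂ] HDot := UniformSpace.Completion.toComplₗᵢ

theorem denseRange_toHDot : DenseRange toHDot := UniformSpace.Completion.denseRange_coe

theorem H1_le : H1 ≤ (absD (1 / 2)).domain := by
  intro u hu
  have h1 : MemLp (fun ξ => ‖(𝓕 u : L2) ξ‖ +
      ‖((2 * Real.pi * ξ : ℝ) : ℂ) * (𝓕 u : L2) ξ‖) 2 volume :=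
    (Lp.memLp (𝓕 u : L2)).norm.add (MemLp.norm hu)
  refine h1.mono (AEStronglyMeasurable.mul (Measurable.aestronglyMeasurable (by fun_prop))
    (Lp.aestronglyMeasurable _)) (Eventually.of_forall fun ξ => ?_)
  set t := |2 * Real.pi * ξ| with ht
  have ht0 : 0 ≤ t := abs_nonneg _
  have h2 : t ^ (1 / 2 : ℝ) ≤ 1 + t := by
    rw [← Real.sqrt_eq_rpow]
    refine Real.sqrt_le_iff.2 ⟨by positivity, by nlinarith⟩
  rw [norm_mul, norm_mul, Complex.norm_real, Complex.norm_real, Real.norm_eq_abs, Real.norm_eq_abs,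
    ← ht, abs_of_nonneg (Real.rpow_nonneg ht0 _), Real.norm_eq_abs, abs_of_nonneg (by positivity)]
  nlinarith [norm_nonneg ((𝓕 u : L2) ξ)]

/-- The inclusion of `H¹(ℝ)` into `H^{1/2}(ℝ)`. -/
def H1.toHHalf : H1 →ₗ[ℂ] HHalf := Submodule.inclusion H1_le

theorem toL2_toHHalf (u : H1) : toL2 (H1.toHHalf u) = u := rfl

/-- The inclusion of `H¹(ℝ)` into `Ḣ^{1/2}(ℝ)`. -/
def H1.toHDot : H1 →ₗ[ℂ] HDot := HamKrein.toHDot.toLinearMap ∘ₗ H1.toHHalf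

/-! ### The operator `𝒥` -/

theorem norm_sign_le (ξ : ℝ) : ‖((Real.sign ξ : ℝ) : ℂ)‖ ≤ 1 := by
  rcases Real.sign_apply_eq ξ with h | h | h <;> simp [h]

theorem measurable_sign : Measurable fun ξ : ℝ => ((Real.sign ξ : ℝ) : ℂ) := by
  refine Complex.measurable_ofReal.comp ?_
  unfold Real.sign
  exact Measurable.ite measurableSet_Iio measurable_const
    (Measurable.ite measurableSet_Ioi measurable_const measurable_const)

theorem sgnD_domain : sgnD.domain = ⊤ := by
  refine eq_top_iff.2 fun u _ => ?_
  refine (Lp.memLp (𝓕 u : L2)).mono (measurable_sign.aestronglyMeasurable.mul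
    (Lp.aestronglyMeasurable _)) (Eventually.of_forall fun ξ => ?_)
  rw [norm_mul]
  exact mul_le_of_le_one_left (norm_nonneg _) (norm_sign_le ξ)

theorem sgnD_mem (u : HHalf) : sgnD ⟨toL2 u, sgnD_domain ▸ Submodule.mem_top⟩ ∈
    (absD (1 / 2)).domain := by
  have h1 : MemLp (fun ξ => ((|2 * Real.pi * ξ| ^ (1 / 2 : ℝ) : ℝ) : ℂ) * (𝓕 (toL2 u) : L2) ξ)
    2 volume := u.2
  refine h1.mono (AEStronglyMeasurable.mul (Measurable.aestronglyMeasurable (by fun_prop))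
    (Lp.aestronglyMeasurable _)) ?_
  filter_upwards [fourier_fourierMult _
    (⟨toL2 u, sgnD_domain ▸ Submodule.mem_top⟩ : sgnD.domain)] with ξ hξ
  change ‖_ * (𝓕 (fourierMult _ _) : L2) ξ‖ ≤ _
  rw [hξ, norm_mul, norm_mul, norm_mul]
  gcongr
  exact mul_le_of_le_one_left (norm_nonneg _) (norm_sign_le ξ)

/-- The map `u ↦ 𝓕⁻¹ (sgn · 𝓕 u)` on `H^{1/2}(ℝ)`. -/
def J₀ : HHalf →ₗ[ℂ] HHalf where
  toFun u := ⟨sgnD ⟨toL2 u, sgnD_domain ▸ Submodule.mem_top⟩, sgnD_mem u⟩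
  map_add' u v := Subtype.ext (sgnD.map_add ⟨toL2 u, sgnD_domain ▸ Submodule.mem_top⟩
    ⟨toL2 v, sgnD_domain ▸ Submodule.mem_top⟩)
  map_smul' c u := Subtype.ext (sgnD.map_smul c ⟨toL2 u, sgnD_domain ▸ Submodule.mem_top⟩)

theorem fourier_J₀ (u : HHalf) : (𝓕 (toL2 (J₀ u)) : L2) =ᵐ[volume]
    fun ξ => ((Real.sign ξ : ℝ) : ℂ) * (𝓕 (toL2 u) : L2) ξ :=
  fourier_fourierMult _ (⟨toL2 u, sgnD_domain ▸ Submodule.mem_top⟩ : sgnD.domain)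

theorem norm_J₀_le (u : HHalf) : ‖J₀ u‖ ≤ ‖u‖ := by
  rw [norm_HHalf, norm_HHalf, ← Lp.norm_fourier_eq (sqrtAbsD (J₀ u)),
    ← Lp.norm_fourier_eq (sqrtAbsD u)]
  refine Lp.norm_le_norm_of_ae_le ?_
  filter_upwards [fourier_sqrtAbsD (J₀ u), fourier_sqrtAbsD u, fourier_J₀ u] with ξ h1 h2 h3
  rw [h1, h2, h3, norm_mul, norm_mul, norm_mul]
  gcongr
  exact mul_le_of_le_one_left (norm_nonneg _) (norm_sign_le ξ)

/-- The bounded operator `𝒥 u = 𝓕⁻¹ (sgn · 𝓕 u)` on `Ḣ^{1/2}(ℝ)`, extended by continuity from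
`H^{1/2}(ℝ)`. -/
def J : HDot →L[ℂ] HDot :=
  (toHDot.toLinearMap ∘ₗ J₀).extendOfNorm toHDot.toLinearMap

theorem J_toHDot (u : HHalf) : J (toHDot u) = toHDot (J₀ u) :=
  LinearMap.extendOfNorm_eq (e := toHDot.toLinearMap) denseRange_toHDot
    ⟨1, fun x => by simpa using norm_J₀_le x⟩ u

/-! ### The maximal Schrödinger operator `H_V` in `L²(ℝ)` -/

/-- The differential expression `τ_V f = - c² f'' + b² f + V f`. -/
def tau (b c : ℝ) (V : ℝ → ℝ) (f : ℝ → ℂ) (x : ℝ) : ℂ :=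
  -(c : ℂ) ^ 2 * deriv (deriv f) x + (b : ℂ) ^ 2 * f x + (V x : ℂ) * f x

/-- `f` and `f'` are locally absolutely continuous (a locally absolutely continuous function whose
derivative is locally absolutely continuous is continuously differentiable). -/
structure ACLoc₂ (f : ℝ → ℂ) : Prop where
  diff : Differentiable ℝ f
  ac : ∀ α β : ℝ, AbsolutelyContinuousOnInterval f α β
  ac_deriv : ∀ α β : ℝ, AbsolutelyContinuousOnInterval (deriv f) α β

theorem ACLoc₂.ae_diff {f : ℝ → ℂ} (hf : ACLoc₂ f) :
    ∀ᵐ x : ℝ, DifferentiableAt ℝ (deriv f) x := by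
  have h : ∀ n : ℕ, ∀ᵐ x : ℝ, x ∈ Set.uIcc (-(n : ℝ)) n → DifferentiableAt ℝ (deriv f) x :=
    fun n => (hf.ac_deriv (-(n : ℝ)) n).boundedVariationOn.ae_differentiableAt_of_mem_uIcc
  filter_upwards [ae_all_iff.2 h] with x hx
  obtain ⟨n, hn⟩ := exists_nat_ge |x|
  refine hx n (Set.mem_uIcc.2 (Or.inl (abs_le.1 hn)))

theorem ACLoc₂.add {f g : ℝ → ℂ} (hf : ACLoc₂ f) (hg : ACLoc₂ g) : ACLoc₂ (f + g) := by
  have h : deriv (f + g) = deriv f + deriv g := funext fun x => deriv_add (hf.diff x) (hg.diff x)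
  exact ⟨hf.diff.add hg.diff, fun α β => (hf.ac α β).add (hg.ac α β),
    fun α β => h ▸ (hf.ac_deriv α β).add (hg.ac_deriv α β)⟩

theorem ACLoc₂.smul {f : ℝ → ℂ} (z : ℂ) (hf : ACLoc₂ f) : ACLoc₂ (z • f) := by
  have h : deriv (z • f) = z • deriv f := funext fun x => deriv_const_smul z (hf.diff x)
  exact ⟨hf.diff.const_smul z, fun α β => (hf.ac α β).const_smul z,
    fun α β => h ▸ (hf.ac_deriv α β).const_smul z⟩

theorem ACLoc₂.zero : ACLoc₂ 0 := by
  have h : AbsolutelyContinuousOnInterval (0 : ℝ → ℂ) = fun _ _ => True := by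
    ext α β
    simp only [iff_true]
    exact ContDiffOn.absolutelyContinuousOnInterval contDiff_const.contDiffOn
  have h' : deriv (0 : ℝ → ℂ) = 0 := funext fun x => by simp
  exact ⟨differentiable_const 0, fun α β => by rw [h]; trivial, fun α β => by rw [h', h]; trivial⟩

theorem tau_add {b c : ℝ} {V : ℝ → ℝ} {f g : ℝ → ℂ} (hf : ACLoc₂ f) (hg : ACLoc₂ g) :
    tau b c V (f + g) =ᵐ[volume] tau b c V f + tau b c V g := by
  have h : deriv (f + g) = deriv f + deriv g := funext fun x => deriv_add (hf.diff x) (hg.diff x)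
  filter_upwards [hf.ae_diff, hg.ae_diff] with x h1 h2
  simp only [tau, h, Pi.add_apply, deriv_add h1 h2]
  ring

theorem tau_smul {b c : ℝ} {V : ℝ → ℝ} {f : ℝ → ℂ} (z : ℂ) (hf : ACLoc₂ f) :
    tau b c V (z • f) =ᵐ[volume] z • tau b c V f := by
  have h : deriv (z • f) = z • deriv f := funext fun x => deriv_const_smul z (hf.diff x)
  filter_upwards [hf.ae_diff] with x h1
  simp only [tau, h, Pi.smul_apply, deriv_const_smul z h1, smul_eq_mul]
  ring

/-- The graph of `H_V`: the pairs `(u, τ_V u)` with `u, τ_V u ∈ L²(ℝ)` and `u, u'` locally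
absolutely continuous. -/
def schrodingerGraph (b c : ℝ) (V : ℝ → ℝ) : Submodule ℂ (L2 × L2) where
  carrier := {p | ∃ f : ℝ → ℂ, ACLoc₂ f ∧ p.1 =ᵐ[volume] f ∧ p.2 =ᵐ[volume] tau b c V f}
  zero_mem' := by
    refine ⟨0, ACLoc₂.zero, Lp.coeFn_zero _ _ _, ?_⟩
    have h' : deriv (0 : ℝ → ℂ) = 0 := funext fun x => by simp
    filter_upwards [Lp.coeFn_zero ℂ 2 (volume : Measure ℝ)] with x hx
    simp only [Prod.snd_zero, hx, tau, h']
    simp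
  add_mem' := by
    rintro p q ⟨f, hf, hp, hp'⟩ ⟨g, hg, hq, hq'⟩
    exact ⟨f + g, hf.add hg, (Lp.coeFn_add _ _).trans (hp.add hq),
      ((Lp.coeFn_add _ _).trans (hp'.add hq')).trans (tau_add hf hg).symm⟩
  smul_mem' := by
    rintro z p ⟨f, hf, hp, hp'⟩
    exact ⟨z • f, hf.smul z, (Lp.coeFn_smul _ _).trans (hp.const_smul z),
      ((Lp.coeFn_smul _ _).trans (hp'.const_smul z)).trans (tau_smul z hf).symm⟩

theorem schrodingerGraph_functional (b c : ℝ) (V : ℝ → ℝ) (p : L2 × L2)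
    (hp : p ∈ schrodingerGraph b c V) (h0 : p.1 = 0) : p.2 = 0 := by
  obtain ⟨f, hf, h1, h2⟩ := hp
  rw [h0] at h1
  have h3 : f = 0 := Continuous.ae_eq_iff_eq volume hf.diff.continuous continuous_zero |>.1
    (h1.symm.trans (Lp.coeFn_zero _ _ _))
  subst h3
  have h' : deriv (0 : ℝ → ℂ) = 0 := funext fun x => by simp
  apply Lp.ext
  filter_upwards [h2, Lp.coeFn_zero ℂ 2 (volume : Measure ℝ)] with x hx hx'
  rw [hx, hx']
  simp [tau, h']

/-- The maximal operator `H_V` associated in `L²(ℝ)` with `τ_V = - c² d²/dx² + b² + V`. -/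
def HV (b c : ℝ) (V : ℝ → ℝ) : L2 →ₗ.[ℂ] L2 := (schrodingerGraph b c V).toLinearPMap

theorem HV_graph (b c : ℝ) (V : ℝ → ℝ) : (HV b c V).graph = schrodingerGraph b c V :=
  Submodule.toLinearPMap_graph_eq _ (schrodingerGraph_functional b c V)

/-! ### The operators `ℒ` and `𝒜` in `Ḣ^{1/2}(ℝ)` -/

/-- The sesquilinear form `𝔱_V[u, v] = c² (u', v')_{L²} + b² (u, v)_{L²} + ∫ V u v̄` on `H¹(ℝ)`,
linear in `u` and antilinear in `v`; Mathlib's inner products are antilinear in their first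
argument, and `(u', v')_{L²} = (D u, D v)_{L²}`. -/
def tV (b c : ℝ) (V : ℝ → ℝ) (u v : H1) : ℂ :=
  (c : ℂ) ^ 2 * inner ℂ (D v) (D u) + (b : ℂ) ^ 2 * inner ℂ (v : L2) (u : L2) +
    ∫ x, (V x : ℂ) * (u : L2) x * conj ((v : L2) x)

/-- The graph of the operator associated with the form `𝔱_V` in `Ḣ^{1/2}(ℝ)`: the pairs `(u, w)`
with `u ∈ H¹(ℝ)`, `w ∈ Ḣ^{1/2}(ℝ)` and `𝔱_V[u, v] = (w, v)_{Ḣ^{1/2}}` for all `v ∈ H¹(ℝ)`, where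
the integral in `𝔱_V[u, v]` is required to exist. -/
def formGraph (b c : ℝ) (V : ℝ → ℝ) : Submodule ℂ (HDot × HDot) where
  carrier := {p | ∃ u : H1, H1.toHDot u = p.1 ∧ ∀ v : H1,
    Integrable (fun x => (V x : ℂ) * (u : L2) x * conj ((v : L2) x)) ∧
      tV b c V u v = inner ℂ (H1.toHDot v) p.2}
  zero_mem' := by
    have h : ∀ v : H1, (fun x => (V x : ℂ) * ((0 : H1) : L2) x * conj ((v : L2) x)) =ᵐ[volume]
        fun _ => (0 : ℂ) := fun v => by
      filter_upwards [Lp.coeFn_zero ℂ 2 (volume : Measure ℝ)] with x hx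
      rw [Submodule.coe_zero, hx]
      simp
    refine ⟨0, map_zero _, fun v => ⟨(integrable_zero _ _ _).congr (h v).symm, ?_⟩⟩
    rw [tV, integral_congr_ae (h v)]
    simp [LinearPMap.map_zero]
  add_mem' := by
    rintro p q ⟨u, hu, hu'⟩ ⟨w, hw, hw'⟩
    have h : ∀ v : H1, (fun x => (V x : ℂ) * ((u + w : H1) : L2) x * conj ((v : L2) x)) =ᵐ[volume]
        fun x => (V x : ℂ) * (u : L2) x * conj ((v : L2) x) +
          (V x : ℂ) * (w : L2) x * conj ((v : L2) x) := fun v => by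
      filter_upwards [Lp.coeFn_add (u : L2) (w : L2)] with x hx
      rw [Submodule.coe_add, hx, Pi.add_apply]
      ring
    refine ⟨u + w, by rw [map_add, hu, hw]; rfl, fun v =>
      ⟨((hu' v).1.add (hw' v).1).congr (h v).symm, ?_⟩⟩
    rw [Prod.snd_add, inner_add_right, ← (hu' v).2, ← (hw' v).2, tV, tV, tV,
      integral_congr_ae (h v), integral_add (hu' v).1 (hw' v).1, LinearPMap.map_add,
      Submodule.coe_add, inner_add_right, inner_add_right]
    ring
  smul_mem' := by
    rintro z p ⟨u, hu, hu'⟩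
    have h : ∀ v : H1, (fun x => (V x : ℂ) * ((z • u : H1) : L2) x * conj ((v : L2) x)) =ᵐ[volume]
        fun x => z * ((V x : ℂ) * (u : L2) x * conj ((v : L2) x)) := fun v => by
      filter_upwards [Lp.coeFn_smul z (u : L2)] with x hx
      rw [Submodule.coe_smul, hx, Pi.smul_apply, smul_eq_mul]
      ring
    refine ⟨z • u, by rw [map_smul, hu]; rfl, fun v =>
      ⟨((hu' v).1.const_mul z).congr (h v).symm, ?_⟩⟩
    rw [Prod.smul_snd, inner_smul_right, ← (hu' v).2, tV, tV,
      integral_congr_ae (h v), integral_const_mul, LinearPMap.map_smul,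
      Submodule.coe_smul, inner_smul_right, inner_smul_right]
    ring

theorem denseRange_H1_sqrtAbsD : DenseRange fun v : H1 => (𝓕 (sqrtAbsD (H1.toHHalf v)) : L2) := by
  let S : H1 →ₗ[ℂ] L2 := (Lp.fourierTransformₗᵢ ℝ ℂ).toLinearEquiv.toLinearMap ∘ₗ
    sqrtAbsD ∘ₗ H1.toHHalf
  suffices h : (LinearMap.range S)ᗮ = ⊥ by
    have h' := Submodule.topologicalClosure_eq_top_iff.2 h
    have h'' := Submodule.dense_iff_topologicalClosure_eq_top.2 h'
    exact h''
  refine (Submodule.eq_bot_iff _).2 fun g hg => ?_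
  have hbd : ∀ s : ℝ → ℝ, Measurable s → (∀ ξ, |s ξ| ≤ 1) →
      MemLp (fun ξ => (s ξ : ℂ) * g ξ) 2 volume := fun s hs hs' =>
    (Lp.memLp g).mono ((Complex.measurable_ofReal.comp hs).aestronglyMeasurable.mul
      (Lp.aestronglyMeasurable _)) (Eventually.of_forall fun ξ => by
        rw [norm_mul, Complex.norm_real]
        exact mul_le_of_le_one_left (norm_nonneg _) (hs' ξ))
  have hr : ∀ t : ℝ, 0 ≤ t → t ^ (1 / 2 : ℝ) ≤ 1 + t := fun t ht => by
    rw [← Real.sqrt_eq_rpow]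
    refine Real.sqrt_le_iff.2 ⟨by positivity, by nlinarith⟩
  have hr0 : ∀ t : ℝ, 0 ≤ t → 0 ≤ t ^ (1 / 2 : ℝ) := fun t ht => Real.rpow_nonneg ht _
  let m : ℝ → ℝ := fun ξ => |2 * Real.pi * ξ|
  have hm : ∀ ξ, 0 ≤ m ξ := fun ξ => abs_nonneg _
  have hmm : Measurable m := by fun_prop
  have h1 := hbd (fun ξ => m ξ ^ (1 / 2 : ℝ) / (1 + m ξ) ^ 2) (by fun_prop) fun ξ => by
    have := hm ξ
    rw [abs_of_nonneg (div_nonneg (hr0 _ this) (by positivity)), div_le_one (by positivity)]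
    nlinarith [hr _ this]
  have h2 := hbd (fun ξ => 2 * Real.pi * ξ * (m ξ ^ (1 / 2 : ℝ) / (1 + m ξ) ^ 2)) (by fun_prop)
    fun ξ => by
      have := hm ξ
      rw [abs_mul, abs_of_nonneg (div_nonneg (hr0 _ this) (by positivity : 0 ≤ (1 + m ξ) ^ 2)),
        ← mul_div_assoc, div_le_one (by positivity)]
      change m ξ * _ ≤ _
      nlinarith [hr _ this, hr0 _ this]
  have h3 := hbd (fun ξ => m ξ ^ (1 / 2 : ℝ) / (1 + m ξ)) (by fun_prop) fun ξ => by
    have := hm ξ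
    rw [abs_of_nonneg (div_nonneg (hr0 _ this) (by positivity)), div_le_one (by positivity)]
    exact hr _ this
  have hF : (𝓕 (𝓕⁻ (h1.toLp _) : L2) : L2) =ᵐ[volume]
      fun ξ => ((m ξ ^ (1 / 2 : ℝ) / (1 + m ξ) ^ 2 : ℝ) : ℂ) * g ξ := by
    rw [FourierTransform.fourier_fourierInv_eq]
    exact h1.coeFn_toLp
  have hv : (𝓕⁻ (h1.toLp _) : L2) ∈ H1 := by
    refine (memLp_congr_ae ?_).2 h2
    filter_upwards [hF] with ξ hξ
    rw [hξ]
    push_cast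
    ring
  have hS := Submodule.inner_right_of_mem_orthogonal (LinearMap.mem_range_self S ⟨_, hv⟩) hg
  have hh : inner ℂ (h3.toLp _) (h3.toLp _) = 0 := by
    rw [← hS, L2.inner_def, L2.inner_def]
    refine integral_congr_ae ?_
    filter_upwards [h3.coeFn_toLp, hF, fourier_sqrtAbsD (H1.toHHalf ⟨_, hv⟩)] with ξ e1 e2 e3
    have e4 : S ⟨_, hv⟩ ξ = ((m ξ ^ (1 / 2 : ℝ) : ℝ) : ℂ) *
        (((m ξ ^ (1 / 2 : ℝ) / (1 + m ξ) ^ 2 : ℝ) : ℂ) * g ξ) := by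
      rw [← e2]; exact e3
    rw [e1, e4, ← mul_assoc, ← Complex.ofReal_mul, ← Complex.real_smul, ← Complex.real_smul,
      inner_smul_left_eq_star_smul, inner_smul_left_eq_star_smul, inner_smul_right_eq_smul,
      smul_smul]
    congr 1
    have := hm ξ
    simp only [conj_trivial]
    field_simp
  have h4 := inner_self_eq_zero.1 hh
  apply Lp.ext
  have h5 := h3.coeFn_toLp
  rw [h4] at h5
  filter_upwards [h5, Lp.coeFn_zero ℂ 2 (volume : Measure ℝ), ae_ne_zero] with ξ e1 e2 e3
  rw [e2] at e1 ⊢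
  refine (mul_eq_zero.1 e1.symm).resolve_left ?_
  have e4 : 0 < m ξ ^ (1 / 2 : ℝ) / (1 + m ξ) :=
    div_pos (symbol_pos e3) (add_pos_of_pos_of_nonneg one_pos (hm ξ))
  exact_mod_cast e4.ne'

theorem denseRange_H1_toHDot : DenseRange H1.toHDot := by
  let S : HHalf →ₗᵢ[ℂ] L2 :=
    (Lp.fourierTransformₗᵢ ℝ ℂ).toLinearIsometry.comp ⟨sqrtAbsD, fun _ => rfl⟩
  have h : DenseRange H1.toHHalf := fun u => by
    rw [S.isometry.isUniformInducing.isInducing.closure_eq_preimage_closure_image, ← Set.range_comp]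
    exact denseRange_H1_sqrtAbsD (S u)
  exact denseRange_toHDot.comp h toHDot.continuous

theorem formGraph_functional (b c : ℝ) (V : ℝ → ℝ) (p : HDot × HDot)
    (hp : p ∈ formGraph b c V) (h0 : p.1 = 0) : p.2 = 0 := by
  obtain ⟨u, hu, hu'⟩ := hp
  have hu0 : u = 0 := by
    rw [h0] at hu
    have h1 : H1.toHHalf u = 0 := toHDot.injective (by rw [map_zero]; exact hu)
    exact Submodule.inclusion_injective H1_le (by rw [map_zero]; exact h1)
  subst hu0
  have h : ∀ v : H1, (fun x => (V x : ℂ) * ((0 : H1) : L2) x * conj ((v : L2) x)) =ᵐ[volume]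
      fun _ => (0 : ℂ) := fun v => by
    filter_upwards [Lp.coeFn_zero ℂ 2 (volume : Measure ℝ)] with x hx
    rw [Submodule.coe_zero, hx]
    simp
  have h2 : ∀ v : H1, inner ℂ (H1.toHDot v) p.2 = 0 := fun v => by
    rw [← (hu' v).2, tV, integral_congr_ae (h v)]
    simp [LinearPMap.map_zero]
  have h3 : ∀ y : HDot, inner ℂ y p.2 = 0 := fun y =>
    denseRange_H1_toHDot.induction_on y
      (isClosed_eq (continuous_id.inner continuous_const) continuous_const) h2
  exact inner_self_eq_zero.1 (h3 p.2)

/-- The self-adjoint operator `ℒ` associated with the form `𝔱_V` in `Ḣ^{1/2}(ℝ)`. -/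
def calL (b c : ℝ) (V : ℝ → ℝ) : HDot →ₗ.[ℂ] HDot := (formGraph b c V).toLinearPMap

theorem calL_graph (b c : ℝ) (V : ℝ → ℝ) : (calL b c V).graph = formGraph b c V :=
  Submodule.toLinearPMap_graph_eq _ (formGraph_functional b c V)

/-- The operator `𝒜 = 𝒥 ℒ` in `Ḣ^{1/2}(ℝ)`, with `dom 𝒜 = dom ℒ`. -/
def calA (b c : ℝ) (V : ℝ → ℝ) : HDot →ₗ.[ℂ] HDot := J.toLinearMap.compPMap (calL b c V)

/-! ### Iterated kernels and generalized eigenspaces -/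

/-- `ker (H_V - z D) = {u ∈ dom H_V ∩ H¹(ℝ) : H_V u = z D u}`. -/
def kerHV (b c : ℝ) (V : ℝ → ℝ) (z : ℂ) : Submodule ℂ L2 := pker (HV b c V - z • D)

/-- `ker (ℒ - z 𝒥)`. -/
def kerL (b c : ℝ) (V : ℝ → ℝ) (z : ℂ) : Submodule ℂ HDot :=
  pker (calL b c V - z • J.toLinearMap.toPMap ⊤)

/-- The spaces `ker ((D⁻¹ H_V - z) ^ n)`: `{0}` for `n = 0`, `ker (H_V - z D)` for `n = 1`, and
`ker ((D⁻¹ H_V - z) ^ (n + 1)) = {u ∈ dom H_V : H_V u - z D u ∈ D (ker ((D⁻¹ H_V - z) ^ n))}` for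
`n ≥ 1`. -/
def kerHVPow (b c : ℝ) (V : ℝ → ℝ) (z : ℂ) : ℕ → Submodule ℂ L2
  | 0 => ⊥
  | 1 => kerHV b c V z
  | n + 2 =>
    ((((kerHVPow b c V z (n + 1)).comap D.domain.subtype).map D.toFun).comap
      (HV b c V - z • D).toFun).map (HV b c V - z • D).domain.subtype

/-- The spaces `ker ((𝒜 - z) ^ n)`. -/
def kerAPow (b c : ℝ) (V : ℝ → ℝ) (z : ℂ) (n : ℕ) : Submodule ℂ HDot :=
  pker (ppow (calA b c V - z • LinearMap.id.toPMap ⊤) n)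

/-- The generalized eigenspace `E_z(A) = ⋃ₙ ker ((D⁻¹ H_V - z) ^ n)`. -/
def genEigHV (b c : ℝ) (V : ℝ → ℝ) (z : ℂ) : Set L2 := ⋃ n : ℕ, (kerHVPow b c V z n : Set L2)

/-- The generalized eigenspace `E_z(𝒜) = ⋃ₙ ker ((𝒜 - z) ^ n)`. -/
def genEigA (b c : ℝ) (V : ℝ → ℝ) (z : ℂ) : Set HDot := ⋃ n : ℕ, (kerAPow b c V z n : Set HDot)

/-- A subset `S` of `L²(ℝ)` and a subset `T` of `Ḣ^{1/2}(ℝ)` coincide: they are one and the same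
set of elements of `H^{1/2}(ℝ)`, which is included in both spaces. -/
def Coincide (S : Set L2) (T : Set HDot) : Prop :=
  ∃ K : Set HHalf, toL2 '' K = S ∧ toHDot '' K = T

end HamKrein

end

noncomputable section

namespace HamKrein

/-! ### Primitives of locally integrable functions -/

/-! Everything rests on two identities. On the Fourier side `|λ| sgn λ = λ`, so `(v, 𝒥w)_{Ḣ^{1/2}} =
(v, Dw)_{L²}` for `v, w` in `H¹` (`inner_toHDot_J`), and `sgn² = 1` almost everywhere, so `𝒥² = 1`
(`J_J`). Consequently, for `u, w` in `H¹`, `ℒu = 𝒥w` means `𝔱_V[u, v] = (Dw, v)_{L²}` for all `v` in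
`H¹`, and this holds exactly when `H_V u = Dw` (`mem_formGraph_iff`). With `w = zu + y` the relation
`(𝒜 - z)u = y` becomes `H_V u - zDu = Dy`, and induction on `n` identifies the iterated kernels
(`coincideH1_kerPow`).

The analytic work is the equivalence between the form equation and the differential equation for `u`
in `H¹` and `g` in `L²`. From `H_V u = g`, integration by parts on the whole line gives the form
equation (`tV_eq_of_mem_schrodingerGraph`): an integrable primitive with integrable derivative
leaves no boundary terms, and `V u v̄` is integrable by a form bound which needs only that
`∫_y^{y+1} |V|` is bounded in `y`. Conversely, testing with smooth compactly supported `v`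
identifies the weak derivative of `u'`, and the lemma of du Bois-Reymond supplies a locally
absolutely continuous representative (`mem_schrodingerGraph_of_tV_eq`).

The kernels of `H_V - zD` lie in `H¹` through the domain of `D`. Only `ker H_V` needs the inclusion
of `dom H_V` in `H¹`, which is an energy estimate on `[-R, R]` (`mem_H1_of_mem_schrodingerGraph`).
-/

/-- `f` is a locally absolutely continuous primitive of the locally integrable function `p`. -/
structure IsPrimitive (f p : ℝ → ℂ) : Prop where
  locInt : LocallyIntegrable p volume
  eq : ∀ x, f x = f 0 + ∫ t in (0 : ℝ)..x, p t

theorem locInt_interval {E : Type*} [NormedAddCommGroup E] {p : ℝ → E}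
    (hp : LocallyIntegrable p volume) (α β : ℝ) : IntervalIntegrable p volume α β :=
  intervalIntegrable_iff.2
    ((hp.integrableOn_isCompact isCompact_uIcc).mono_set Set.uIoc_subset_uIcc)

theorem locInt_norm {E : Type*} [NormedAddCommGroup E] {p : ℝ → E}
    (hp : LocallyIntegrable p volume) : LocallyIntegrable (fun x => ‖p x‖) volume := fun x => by
  obtain ⟨s, hs, hi⟩ := hp x
  exact ⟨s, hs, hi.norm⟩

theorem locInt_continuous_mul {p f : ℝ → ℂ} (hp : LocallyIntegrable p volume)
    (hf : Continuous f) : LocallyIntegrable (fun x => f x * p x) volume := by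
  have h := (locallyIntegrableOn_univ.2 hp).continuousOn_mul
    hf.continuousOn isOpen_univ.isLocallyClosed
  exact locallyIntegrableOn_univ.1 h

theorem locInt_mul_continuous {p f : ℝ → ℂ} (hp : LocallyIntegrable p volume)
    (hf : Continuous f) : LocallyIntegrable (fun x => p x * f x) volume := by
  simpa only [mul_comm] using locInt_continuous_mul hp hf

theorem locInt_congr {p q : ℝ → ℂ} (hp : LocallyIntegrable p volume)
    (h : p =ᵐ[volume] q) : LocallyIntegrable q volume := fun x => by
  obtain ⟨s, hs, hi⟩ := hp x
  exact ⟨s, hs, hi.congr (ae_restrict_of_ae h)⟩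

theorem locallyIntegrable_L2 (u : L2) : LocallyIntegrable u volume :=
  (Lp.memLp u).locallyIntegrable (by norm_num)

/-- The increments are dominated by those of the real primitive of `‖p‖`. -/
theorem absolutelyContinuous_integral {p : ℝ → ℂ} (hp : LocallyIntegrable p volume)
    (γ α β : ℝ) : AbsolutelyContinuousOnInterval (fun x => ∫ t in γ..x, p t) α β := by
  have hn : LocallyIntegrable (fun x => ‖p x‖) volume := locInt_norm hp
  have h1 := (locInt_interval hn α β).absolutelyContinuousOnInterval_intervalIntegral
    (c := α) Set.left_mem_uIcc
  refine squeeze_zero (fun E => Finset.sum_nonneg fun i _ => dist_nonneg)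
    (fun E => Finset.sum_le_sum fun i _ => ?_) h1
  rw [dist_comm, dist_comm (∫ v in α..(E.2 i).1, ‖p v‖), dist_eq_norm, Real.dist_eq,
    intervalIntegral.integral_interval_sub_left (locInt_interval hp _ _) (locInt_interval hp _ _),
    intervalIntegral.integral_interval_sub_left (locInt_interval hn _ _) (locInt_interval hn _ _)]
  exact intervalIntegral.norm_integral_le_abs_integral_norm

theorem absolutelyContinuous_conj {f : ℝ → ℂ} {α β : ℝ}
    (hf : AbsolutelyContinuousOnInterval f α β) :
    AbsolutelyContinuousOnInterval (fun x => conj (f x)) α β := by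
  unfold AbsolutelyContinuousOnInterval at hf ⊢
  simpa only [Complex.dist_conj_conj] using hf

namespace IsPrimitive

variable {f g p q : ℝ → ℂ}

theorem sub_eq (h : IsPrimitive f p) (α β : ℝ) : ∫ t in α..β, p t = f β - f α := by
  rw [h.eq α, h.eq β, ← intervalIntegral.integral_interval_sub_left
    (locInt_interval h.locInt 0 β) (locInt_interval h.locInt 0 α)]
  ring

theorem continuous (h : IsPrimitive f p) : Continuous f := by
  rw [funext h.eq]
  exact continuous_const.add
    (intervalIntegral.continuous_primitive (locInt_interval h.locInt) 0)

theorem ac (h : IsPrimitive f p) (α β : ℝ) : AbsolutelyContinuousOnInterval f α β := by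
  have h1 := absolutelyContinuous_integral h.locInt α α β
  have h2 : AbsolutelyContinuousOnInterval (fun _ : ℝ => f α) α β :=
    ContDiffOn.absolutelyContinuousOnInterval contDiff_const.contDiffOn
  have h3 : f = (fun _ : ℝ => f α) + fun x => ∫ t in α..x, p t := by
    ext x
    simp [h.sub_eq]
  rw [h3]
  exact h2.add h1

theorem ae_hasDerivAt (h : IsPrimitive f p) : ∀ᵐ x, HasDerivAt f (p x) x := by
  filter_upwards [LocallyIntegrable.ae_hasDerivAt_integral h.locInt] with x hx
  rw [funext h.eq]
  exact (hx 0).const_add _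

/-- Subtracting `∫ p` leaves an absolutely continuous function with derivative zero almost
everywhere, hence a constant. The product rule and conjugation follow by checking derivatives almost
everywhere. -/
theorem of_ac (hp : LocallyIntegrable p volume)
    (hf : ∀ α β : ℝ, AbsolutelyContinuousOnInterval f α β)
    (hd : ∀ᵐ x, HasDerivAt f (p x) x) : IsPrimitive f p := by
  refine ⟨hp, fun x => ?_⟩
  have h1 := absolutelyContinuous_integral hp 0 0 x
  obtain ⟨C, hC⟩ := ((hf 0 x).sub h1).const_of_ae_hasDerivAt_zero (by
    filter_upwards [hd, LocallyIntegrable.ae_hasDerivAt_integral hp] with y hy hy' _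
    simpa using! hy.sub (hy' 0))
  have h2 := hC 0 Set.left_mem_uIcc
  have h3 := hC x Set.right_mem_uIcc
  simp only [Pi.sub_apply, intervalIntegral.integral_same, sub_zero] at h2 h3
  rw [h2, ← h3]
  ring

theorem of_hasDerivAt (hp : Continuous p) (hd : ∀ x, HasDerivAt f (p x) x) : IsPrimitive f p := by
  refine ⟨hp.locallyIntegrable, fun x => ?_⟩
  rw [intervalIntegral.integral_eq_sub_of_hasDerivAt (fun y _ => hd y)
    (hp.intervalIntegrable 0 x)]
  ring

theorem hasDerivAt (h : IsPrimitive f p) (hp : Continuous p) (x : ℝ) : HasDerivAt f (p x) x := by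
  rw [funext h.eq]
  exact (intervalIntegral.integral_hasDerivAt_right (hp.intervalIntegrable 0 x)
    hp.stronglyMeasurable.stronglyMeasurableAtFilter hp.continuousAt).const_add _

theorem congr_ae (h : IsPrimitive f p) (hpq : p =ᵐ[volume] q) : IsPrimitive f q := by
  refine ⟨locInt_congr h.locInt hpq, fun x => ?_⟩
  rw [h.eq x, intervalIntegral.integral_congr_ae (hpq.mono fun y hy _ => hy)]

theorem mul (hf : IsPrimitive f p) (hg : IsPrimitive g q) :
    IsPrimitive (fun x => f x * g x) fun x => p x * g x + f x * q x := by
  refine of_ac ((locInt_mul_continuous hf.locInt hg.continuous).add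
    (locInt_continuous_mul hg.locInt hf.continuous))
    (fun α β => (hf.ac α β).smul (hg.ac α β)) ?_
  filter_upwards [hf.ae_hasDerivAt, hg.ae_hasDerivAt] with x h1 h2
  exact h1.mul h2

theorem star (hf : IsPrimitive f p) :
    IsPrimitive (fun x => conj (f x)) fun x => conj (p x) := by
  refine of_ac ?_ (fun α β => absolutelyContinuous_conj (hf.ac α β)) ?_
  · intro x
    obtain ⟨s, hs, hi⟩ := hf.locInt x
    exact ⟨s, hs, (Complex.conjCLE.toContinuousLinearMap.integrable_comp hi :)⟩
  · filter_upwards [hf.ae_hasDerivAt] with x hx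
    exact Complex.conjCLE.toContinuousLinearMap.hasFDerivAt.comp_hasDerivAt x hx

/-- The difference `f R - f (-R)` tends to `∫ p` and is integrable in `R`, so its limit must be
zero. This is integration by parts without boundary terms: no decay of `f` beyond integrability is
needed. -/
theorem integral_eq_zero (h : IsPrimitive f p) (hf : Integrable f) (hp : Integrable p) :
    ∫ x, p x = 0 := by
  have h1 : Tendsto (fun R : ℝ => f R - f (-R)) atTop (𝓝 (∫ x, p x)) := by
    have h2 := intervalIntegral_tendsto_integral hp tendsto_neg_atTop_atBot tendsto_id
    simp only [h.sub_eq] at h2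
    exact h2
  have h2 : IntegrableAtFilter (fun R : ℝ => f R - f (-R)) atTop volume :=
    ⟨Set.univ, univ_mem, (hf.sub hf.comp_neg).integrableOn⟩
  refine h2.eq_zero_of_tendsto (fun s hs => ?_) h1
  obtain ⟨b, hb⟩ := mem_atTop_sets.1 hs
  rw [← top_le_iff, ← Real.volume_Ici (a := b)]
  exact measure_mono hb

end IsPrimitive

/-! ### The lemma of du Bois-Reymond -/

theorem integrable_smul_of_hasCompactSupport {φ : ℝ → ℝ} {h : ℝ → ℂ} (hφ : Continuous φ)
    (hφ' : HasCompactSupport φ) (hh : LocallyIntegrable h volume) :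
    Integrable fun x => φ x • h x :=
  hh.integrable_smul_left_of_hasCompactSupport hφ hφ'

/-- A compactly supported smooth function of mean zero is the derivative of a compactly supported
smooth function. -/
theorem exists_deriv_eq_of_integral_eq_zero {ψ : ℝ → ℝ} (hψ : ContDiff ℝ (⊤ : ℕ∞) ψ)
    (hψ' : HasCompactSupport ψ) (h0 : ∫ x, ψ x = 0) :
    ∃ φ : ℝ → ℝ, ContDiff ℝ (⊤ : ℕ∞) φ ∧ HasCompactSupport φ ∧ deriv φ = ψ := by
  obtain ⟨R, hR⟩ := hψ'.isCompact.isBounded.subset_closedBall 0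
  have hz : ∀ x, x ∉ Set.Icc (-R) R → ψ x = 0 := fun x hx => by
    refine image_eq_zero_of_notMem_tsupport fun hx' => hx ?_
    simpa [Real.closedBall_eq_Icc] using hR hx'
  have hd : ∀ x, HasDerivAt (fun x => ∫ t in -R..x, ψ t) (ψ x) x := fun x =>
    intervalIntegral.integral_hasDerivAt_right (hψ.continuous.intervalIntegrable _ _)
      hψ.continuous.stronglyMeasurable.stronglyMeasurableAtFilter hψ.continuous.continuousAt
  have hd' : deriv (fun x => ∫ t in -R..x, ψ t) = ψ := funext fun x => (hd x).deriv
  refine ⟨fun x => ∫ t in -R..x, ψ t, ?_, ?_, hd'⟩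
  -- Smoothness of order `∞ = ∞ + 1` reduces to smoothness of the derivative.
  · have h1 : ((⊤ : ℕ∞) : WithTop ℕ∞) = (⊤ : ℕ∞) + 1 := by rfl
    rw [h1, contDiff_succ_iff_deriv]
    exact ⟨fun x => (hd x).differentiableAt, by simp, by rwa [hd']⟩
  · refine HasCompactSupport.intro (isCompact_Icc (a := -R) (b := R)) fun x hx => ?_
    -- To the left of `-R` the integrand vanishes; to the right of `R` the primitive equals the full
    -- integral, which is zero by `h0`.
    rcases lt_or_ge x (-R) with hx1 | hx1
    · rw [intervalIntegral.integral_symm, intervalIntegral.integral_of_le hx1.le,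
        integral_Ioc_eq_integral_Ioo, setIntegral_eq_zero_of_forall_eq_zero, neg_zero]
      exact fun y hy => hz y fun h => absurd h.1 (not_le.2 hy.2)
    · have hx2 : R < x := by
        by_contra h
        exact hx ⟨hx1, not_lt.1 h⟩
      rw [← h0, intervalIntegral.integral_of_le hx1, ← integral_Icc_eq_integral_Ioc]
      refine setIntegral_eq_integral_of_forall_compl_eq_zero fun y hy => hz y fun h => hy ?_
      exact ⟨h.1, h.2.trans hx2.le⟩

/-- A locally integrable function with vanishing weak derivative is constant. -/
theorem ae_const_of_integral_deriv_smul_eq_zero {h : ℝ → ℂ} (hh : LocallyIntegrable h volume)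
    (h0 : ∀ φ : ℝ → ℝ, ContDiff ℝ (⊤ : ℕ∞) φ → HasCompactSupport φ →
      ∫ x, deriv φ x • h x = 0) : ∃ C : ℂ, h =ᵐ[volume] fun _ => C := by
  let ρ : ContDiffBump (0 : ℝ) := ⟨1, 2, one_pos, one_lt_two⟩
  have hρ : ContDiff ℝ (⊤ : ℕ∞) (ρ.normed volume) := ρ.contDiff_normed
  have hρ' : HasCompactSupport (ρ.normed volume) := ρ.hasCompactSupport_normed
  have hρi : ∫ x, ρ.normed volume x = 1 := ρ.integral_normed
  refine ⟨∫ x, ρ.normed volume x • h x, ?_⟩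
  refine ae_eq_of_integral_contDiff_smul_eq hh (locallyIntegrable_const _) fun ψ hψ hψ' => ?_
  have hψi := hψ.continuous.integrable_of_hasCompactSupport (μ := volume) hψ'
  have hρi' := hρ.continuous.integrable_of_hasCompactSupport (μ := volume) hρ'
  -- Since `ρ` has mass one, `ψ - (∫ ψ) ρ` has mean zero and is a derivative. Testing against it
  -- gives `∫ ψ h = (∫ ψ)(∫ ρ h)`, which explains the choice of the constant.
  obtain ⟨φ, hφ, hφ', hd⟩ := exists_deriv_eq_of_integral_eq_zero
    (ψ := ψ - (∫ x, ψ x) • ρ.normed volume) (hψ.sub (hρ.const_smul (∫ x, ψ x)))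
    (hψ'.sub (hρ'.smul_left (f := fun _ => ∫ x, ψ x))) (by
      simp only [Pi.sub_apply, Pi.smul_apply]
      rw [integral_sub hψi (hρi'.fun_smul _), integral_smul, hρi]
      simp)
  have h1 := h0 φ hφ hφ'
  rw [hd] at h1
  simp only [Pi.sub_apply, Pi.smul_apply, sub_smul, smul_assoc] at h1
  rw [integral_sub (integrable_smul_of_hasCompactSupport hψ.continuous hψ' hh)
    ((integrable_smul_of_hasCompactSupport hρ.continuous hρ' hh).fun_smul _), integral_smul,
    sub_eq_zero] at h1
  rw [h1, integral_smul_const]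

/-- A locally integrable function with locally integrable weak derivative is almost everywhere
equal to a primitive of the latter. -/
theorem exists_isPrimitive_of_weak {u k : ℝ → ℂ} (hu : LocallyIntegrable u volume)
    (hk : LocallyIntegrable k volume)
    (h : ∀ φ : ℝ → ℝ, ContDiff ℝ (⊤ : ℕ∞) φ → HasCompactSupport φ →
      ∫ x, deriv φ x • u x = -∫ x, φ x • k x) :
    ∃ f : ℝ → ℂ, IsPrimitive f k ∧ u =ᵐ[volume] f := by
  have hK : IsPrimitive (fun x => ∫ t in (0 : ℝ)..x, k t) k := ⟨hk, fun x => by simp⟩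
  -- The difference of `u` and a primitive of `k` has weak derivative zero; the primitive's
  -- contribution is computed by parts against `φ`.
  obtain ⟨C, hC⟩ := ae_const_of_integral_deriv_smul_eq_zero
    (hu.sub hK.continuous.locallyIntegrable) fun φ hφ hφ' => by
      have hφd : Continuous (deriv φ) := hφ.continuous_deriv (by norm_num)
      have i1 := integrable_smul_of_hasCompactSupport hφd hφ'.deriv hu
      have i2 := integrable_smul_of_hasCompactSupport hφd hφ'.deriv
        hK.continuous.locallyIntegrable
      have i3 := integrable_smul_of_hasCompactSupport hφ.continuous hφ' hk
      have i4 := integrable_smul_of_hasCompactSupport hφ.continuous hφ'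
        hK.continuous.locallyIntegrable
      simp only [Pi.sub_apply, smul_sub]
      rw [integral_sub i1 i2, h φ hφ hφ']
      have hφp : IsPrimitive (fun x => (φ x : ℂ)) fun x => ((deriv φ x : ℝ) : ℂ) :=
        IsPrimitive.of_hasDerivAt (Complex.continuous_ofReal.comp hφd) fun x =>
          ((hφ.differentiable (by norm_num) x).hasDerivAt).ofReal_comp
      have h2 := (hφp.mul hK).integral_eq_zero i4 (i2.add i3)
      simp only [Complex.real_smul] at i2 i3 h2 ⊢
      rw [integral_add i2 i3] at h2
      linear_combination -h2
  refine ⟨fun x => C + ∫ t in (0 : ℝ)..x, k t, ⟨hk, fun x => by simp⟩, ?_⟩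
  filter_upwards [hC] with x hx
  simp only [Pi.sub_apply] at hx
  rw [← hx]
  ring

/-! ### Weak derivatives and the Fourier transform -/

open scoped SchwartzMap

theorem fourier_derivCLM (ψ : 𝓢(ℝ, ℂ)) (ξ : ℝ) :
    (𝓕 (SchwartzMap.derivCLM ℂ ℂ ψ) : 𝓢(ℝ, ℂ)) ξ =
      (2 * Real.pi * Complex.I * ξ) * (𝓕 ψ : 𝓢(ℝ, ℂ)) ξ := by
  have h := Real.fourier_deriv (f := ψ) ψ.integrable ψ.differentiable
    (SchwartzMap.derivCLM ℂ ℂ ψ).integrable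
  rw [SchwartzMap.fourier_coe, SchwartzMap.fourier_coe]
  have h' := congrFun h ξ
  rw [smul_eq_mul] at h'
  exact h'

theorem fourier_toLp_derivCLM (ψ : 𝓢(ℝ, ℂ)) :
    (𝓕 ((SchwartzMap.derivCLM ℂ ℂ ψ).toLp 2 : L2) : L2) =ᵐ[volume]
      fun ξ => (2 * Real.pi * Complex.I * ξ) * (𝓕 ψ : 𝓢(ℝ, ℂ)) ξ := by
  rw [SchwartzMap.toLp_fourier_eq]
  filter_upwards [SchwartzMap.coeFn_toLp (𝓕 (SchwartzMap.derivCLM ℂ ℂ ψ)) 2 volume] with ξ hξ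
  rw [hξ, fourier_derivCLM]

theorem fourier_toLp (ψ : 𝓢(ℝ, ℂ)) :
    (𝓕 (ψ.toLp 2 : L2) : L2) =ᵐ[volume] (𝓕 ψ : 𝓢(ℝ, ℂ)) := by
  rw [SchwartzMap.toLp_fourier_eq]
  exact SchwartzMap.coeFn_toLp _ 2 volume

theorem inner_eq_inner_fourier (u v : L2) : inner ℂ u v = inner ℂ (𝓕 u : L2) (𝓕 v : L2) :=
  (Lp.inner_fourier_eq u v).symm

theorem fourier_D (u : H1) : (𝓕 (D u) : L2) =ᵐ[volume]
    fun ξ => ((2 * Real.pi * ξ : ℝ) : ℂ) * (𝓕 (u : L2) : L2) ξ :=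
  fourier_fourierMult _ u

/-- By Plancherel, the sign is that of the conjugate of the imaginary symbol `2πiξ`. The factor `I`
appears because `u' = iDu`. -/
theorem inner_derivCLM_toLp (ψ : 𝓢(ℝ, ℂ)) (u : H1) :
    inner ℂ ((SchwartzMap.derivCLM ℂ ℂ ψ).toLp 2 : L2) (u : L2) =
      -inner ℂ (ψ.toLp 2 : L2) (Complex.I • D u) := by
  rw [inner_smul_right, inner_eq_inner_fourier _ (u : L2), inner_eq_inner_fourier _ (D u),
    L2.inner_def, L2.inner_def, ← integral_const_mul, ← integral_neg]
  refine integral_congr_ae ?_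
  filter_upwards [fourier_toLp_derivCLM ψ, fourier_toLp ψ, fourier_D u] with ξ h1 h2 h3
  rw [h1, h2, h3]
  simp only [RCLike.inner_apply, map_mul, Complex.conj_I, Complex.conj_ofReal, map_ofNat]
  push_cast
  ring

theorem mem_H1_of_weak {u w : L2} (h : ∀ ψ : 𝓢(ℝ, ℂ),
    inner ℂ ((SchwartzMap.derivCLM ℂ ℂ ψ).toLp 2 : L2) u = -inner ℂ (ψ.toLp 2 : L2) w) :
    ∃ hu : u ∈ H1, D ⟨u, hu⟩ = -Complex.I • w := by
  -- Inverse Fourier transforms of test functions are Schwartz functions, so the hypothesis may be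
  -- tested against arbitrary smooth compactly supported functions in the frequency variable.
  have key : ∀ᵐ ξ : ℝ, (2 * Real.pi * Complex.I * ξ) * (𝓕 u : L2) ξ = (𝓕 w : L2) ξ := by
    refine ae_eq_of_integral_contDiff_smul_eq
      (locInt_continuous_mul (locallyIntegrable_L2 _) (by fun_prop))
      (locallyIntegrable_L2 _) fun g hg hg' => ?_
    have hgc : HasCompactSupport fun x => (g x : ℂ) := hg'.comp_left Complex.ofReal_zero
    let G : 𝓢(ℝ, ℂ) := hgc.toSchwartzMap (Complex.ofRealCLM.contDiff.comp hg)
    have hG : ∀ x, G x = g x := fun x => rfl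
    have h1 := h (𝓕⁻ G)
    rw [inner_eq_inner_fourier _ u, inner_eq_inner_fourier _ w, L2.inner_def,
      L2.inner_def] at h1
    have h2 := fourier_toLp_derivCLM (𝓕⁻ G)
    have h3 := fourier_toLp (𝓕⁻ G)
    rw [FourierTransform.fourier_fourierInv_eq] at h2 h3
    have e1 : ∫ ξ, inner ℂ ((𝓕 ((SchwartzMap.derivCLM ℂ ℂ (𝓕⁻ G)).toLp 2 : L2) : L2) ξ)
        ((𝓕 u : L2) ξ) = -∫ ξ, g ξ • ((2 * Real.pi * Complex.I * ξ) * (𝓕 u : L2) ξ) := by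
      rw [← integral_neg]
      refine integral_congr_ae ?_
      filter_upwards [h2] with ξ h4
      rw [h4, hG]
      simp only [RCLike.inner_apply, map_mul, Complex.conj_I, Complex.conj_ofReal, map_ofNat,
        Complex.real_smul]
      ring
    have e2 : ∫ ξ, inner ℂ ((𝓕 ((𝓕⁻ G).toLp 2 : L2) : L2) ξ) ((𝓕 w : L2) ξ) =
        ∫ ξ, g ξ • (𝓕 w : L2) ξ := by
      refine integral_congr_ae ?_
      filter_upwards [h3] with ξ h4
      rw [h4, hG]
      simp only [RCLike.inner_apply, Complex.conj_ofReal, Complex.real_smul]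
      ring
    rw [e1, e2] at h1
    exact neg_injective h1
  have key' : ∀ᵐ ξ : ℝ, ((2 * Real.pi * ξ : ℝ) : ℂ) * (𝓕 u : L2) ξ =
      (𝓕 (-Complex.I • w) : L2) ξ := by
    rw [FourierTransform.fourier_smul]
    filter_upwards [key, Lp.coeFn_smul (-Complex.I) (𝓕 w : L2)] with ξ h1 h2
    rw [h2, Pi.smul_apply, ← h1, smul_eq_mul]
    push_cast
    linear_combination (2 * Real.pi * ξ * (𝓕 u : L2) ξ) * Complex.I_sq
  have hu : u ∈ H1 := (memLp_congr_ae key').2 (Lp.memLp _)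
  refine ⟨hu, fourier_injective (Lp.ext ?_)⟩
  exact (fourier_D ⟨u, hu⟩).trans key'

/-! ### Elements of `H¹(ℝ)` are primitives of square integrable functions -/

theorem integrable_mul_conj (u v : L2) : Integrable fun x => u x * conj (v x) := by
  simpa only [RCLike.inner_apply] using L2.integrable_inner (𝕜 := ℂ) v u

theorem inner_L2_eq (u v : L2) : inner ℂ v u = ∫ x, u x * conj (v x) := by
  simp only [L2.inner_def, RCLike.inner_apply]

theorem exists_isPrimitive_of_H1 (u : H1) : ∃ f : ℝ → ℂ,
    (u : L2) =ᵐ[volume] f ∧ IsPrimitive f (Complex.I • D u : L2) := by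
  obtain ⟨f, hf, huf⟩ := exists_isPrimitive_of_weak (locallyIntegrable_L2 (u : L2))
    (locallyIntegrable_L2 (Complex.I • D u)) fun φ hφ hφ' => by
      have hc : HasCompactSupport fun x => (φ x : ℂ) := hφ'.comp_left Complex.ofReal_zero
      let ψ : 𝓢(ℝ, ℂ) := hc.toSchwartzMap (Complex.ofRealCLM.contDiff.comp hφ)
      have hψ : ∀ x, ψ x = φ x := fun x => rfl
      have hψ' : ∀ x, SchwartzMap.derivCLM ℂ ℂ ψ x = (deriv φ x : ℝ) := fun x =>
        ((hφ.differentiable (by norm_num) x).hasDerivAt.ofReal_comp).deriv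
      have h1 := inner_derivCLM_toLp ψ u
      rw [inner_L2_eq, inner_L2_eq] at h1
      have e1 : ∫ x, deriv φ x • (u : L2) x = ∫ x, (u : L2) x *
          conj (((SchwartzMap.derivCLM ℂ ℂ ψ).toLp 2 : L2) x) := by
        refine integral_congr_ae ?_
        filter_upwards [SchwartzMap.coeFn_toLp (SchwartzMap.derivCLM ℂ ℂ ψ) 2 volume] with x hx
        rw [hx, hψ', Complex.conj_ofReal, Complex.real_smul, mul_comm]
      have e2 : ∫ x, φ x • (Complex.I • D u : L2) x = ∫ x, (Complex.I • D u : L2) x *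
          conj ((ψ.toLp 2 : L2) x) := by
        refine integral_congr_ae ?_
        filter_upwards [SchwartzMap.coeFn_toLp ψ 2 volume] with x hx
        rw [hx, hψ, Complex.conj_ofReal, Complex.real_smul, mul_comm]
      rw [e1, e2, h1]
  exact ⟨f, huf, hf⟩

/-- For Schwartz `ψ` the product `f ψ̄` and its derivative are integrable, so `integral_eq_zero`
gives the weak derivative tested by `mem_H1_of_weak`. -/
theorem mem_H1_of_isPrimitive {u w : L2} {f : ℝ → ℂ} (hu : (u : L2) =ᵐ[volume] f)
    (hf : IsPrimitive f w) : ∃ hu : u ∈ H1, D ⟨u, hu⟩ = -Complex.I • w := by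
  refine mem_H1_of_weak fun ψ => ?_
  have hψ : IsPrimitive ψ (SchwartzMap.derivCLM ℂ ℂ ψ) :=
    IsPrimitive.of_hasDerivAt (SchwartzMap.derivCLM ℂ ℂ ψ).continuous fun x => ψ.hasDerivAt x
  have e0 := SchwartzMap.coeFn_toLp ψ 2 volume
  have e1 := SchwartzMap.coeFn_toLp (SchwartzMap.derivCLM ℂ ℂ ψ) 2 volume
  have i1 : Integrable fun x => f x * conj (ψ x) := by
    refine (integrable_mul_conj u (ψ.toLp 2)).congr ?_
    filter_upwards [hu, e0] with x h1 h2
    rw [h1, h2]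
  have i2 : Integrable fun x => w x * conj (ψ x) := by
    refine (integrable_mul_conj w (ψ.toLp 2)).congr ?_
    filter_upwards [e0] with x h2
    rw [h2]
  have i3 : Integrable fun x => f x * conj (SchwartzMap.derivCLM ℂ ℂ ψ x) := by
    refine (integrable_mul_conj u ((SchwartzMap.derivCLM ℂ ℂ ψ).toLp 2)).congr ?_
    filter_upwards [hu, e1] with x h1 h2
    rw [h1, h2]
  have h := (hf.mul hψ.star).integral_eq_zero i1 (i2.add i3)
  rw [integral_add i2 i3] at h
  rw [inner_L2_eq, inner_L2_eq]
  have e2 : ∫ x, u x * conj (((SchwartzMap.derivCLM ℂ ℂ ψ).toLp 2 : L2) x) =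
      ∫ x, f x * conj (SchwartzMap.derivCLM ℂ ℂ ψ x) := by
    refine integral_congr_ae ?_
    filter_upwards [hu, e1] with x h1 h2
    rw [h1, h2]
  have e3 : ∫ x, w x * conj ((ψ.toLp 2 : L2) x) = ∫ x, w x * conj (ψ x) := by
    refine integral_congr_ae ?_
    filter_upwards [e0] with x h2
    rw [h2]
  rw [e2, e3]
  linear_combination h

/-! ### Form bounds for uniformly locally integrable potentials -/

/-- The unit-interval integral is continuous in its left end point, hence bounded on a compact set,
and is less than one outside it. This uniform bound is all that the later estimates take from the
decay of `V`. -/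
theorem exists_forall_integral_le {V : ℝ → ℝ} (hV : LocallyIntegrable V volume)
    (hlim : Tendsto (fun x : ℝ => ∫ s in x..(x + 1), |V s|) (cocompact ℝ) (𝓝 0)) :
    ∃ M : ℝ, 0 ≤ M ∧ ∀ y, ∫ s in y..(y + 1), |V s| ≤ M := by
  have hn : LocallyIntegrable (fun x => |V x|) volume := locInt_norm hV
  have hc : Continuous fun x : ℝ => ∫ s in x..(x + 1), |V s| := by
    have h1 := intervalIntegral.continuous_primitive (locInt_interval hn) 0
    have h2 : (fun x : ℝ => ∫ s in x..(x + 1), |V s|) =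
        fun x => (∫ s in (0 : ℝ)..(x + 1), |V s|) - ∫ s in (0 : ℝ)..x, |V s| := by
      ext x
      rw [intervalIntegral.integral_interval_sub_left (locInt_interval hn _ _)
        (locInt_interval hn _ _)]
    rw [h2]
    exact (h1.comp (continuous_add_const 1)).sub h1
  obtain ⟨K, hK, hK'⟩ := mem_cocompact.1 (hlim.eventually (gt_mem_nhds one_pos))
  obtain ⟨C, hC⟩ := hK.bddAbove_image hc.continuousOn
  refine ⟨max C 1, le_max_of_le_right zero_le_one, fun y => ?_⟩
  by_cases hy : y ∈ K
  · exact (hC (Set.mem_image_of_mem _ hy)).trans (le_max_left _ _)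
  · exact (le_of_lt (hK' hy)).trans (le_max_right _ _)

theorem lintegral_Icc_le {V : ℝ → ℝ} (hV : LocallyIntegrable V volume) {M : ℝ}
    (hM : ∀ y, ∫ s in y..(y + 1), |V s| ≤ M) (y : ℝ) :
    ∫⁻ x in Set.Icc (y - 1) (y + 1), ENNReal.ofReal |V x| ≤ ENNReal.ofReal (2 * M) := by
  have hn : LocallyIntegrable (fun x => |V x|) volume := locInt_norm hV
  rw [← ofReal_integral_eq_lintegral_ofReal (hn.integrableOn_isCompact isCompact_Icc)
    (Eventually.of_forall fun x => abs_nonneg _), integral_Icc_eq_integral_Ioc,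
    ← intervalIntegral.integral_of_le (by linarith)]
  refine ENNReal.ofReal_le_ofReal ?_
  rw [← intervalIntegral.integral_add_adjacent_intervals (locInt_interval hn (y - 1) y)
    (locInt_interval hn y (y + 1))]
  have h1 := hM (y - 1)
  rw [sub_add_cancel] at h1
  linarith [hM y]

/-- The density controlling `‖f‖²` pointwise. -/
def energy (ε : ℝ) (f p : ℝ → ℂ) (y : ℝ) : ℝ := (1 + ε⁻¹) * ‖f y‖ ^ 2 + ε * ‖p y‖ ^ 2

theorem energy_nonneg {ε : ℝ} (hε : 0 < ε) (f p : ℝ → ℂ) (y : ℝ) : 0 ≤ energy ε f p y := by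
  unfold energy
  positivity

/-- Write `|f x|²` as `|f y|²` plus the integral of `(|f|²)'`, average over `y` in the unit
interval, and apply Young's inequality `2|p||f| ≤ ε|p|² + ε⁻¹|f|²`. With values in `[0, ∞]`, no
square integrability of `p` is required. -/
theorem IsPrimitive.sq_norm_le {f p : ℝ → ℂ} (h : IsPrimitive f p) {ε : ℝ} (hε : 0 < ε)
    {α x : ℝ} (hx : x ∈ Set.Icc α (α + 1)) :
    ENNReal.ofReal (‖f x‖ ^ 2) ≤
      ∫⁻ y in Set.Icc α (α + 1), ENNReal.ofReal (energy ε f p y) := by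
  set J := Set.Icc α (α + 1) with hJ
  have hN := h.mul h.star
  set q : ℝ → ℂ := fun x => p x * conj (f x) + f x * conj (p x) with hq
  have hmf : Measurable fun y => ENNReal.ofReal (‖f y‖ ^ 2) :=
    (h.continuous.norm.pow 2).measurable.ennreal_ofReal
  have h1 : ∀ y ∈ J, ENNReal.ofReal (‖f x‖ ^ 2) ≤
      ENNReal.ofReal (‖f y‖ ^ 2) + ∫⁻ t in J, ‖q t‖ₑ := fun y hy => by
    have h2 := hN.sub_eq y x
    have h3 : ENNReal.ofReal (‖f x‖ ^ 2) ≤ ENNReal.ofReal (‖f y‖ ^ 2) + ‖∫ t in y..x, q t‖ₑ := by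
      rw [← ofReal_norm, ← ENNReal.ofReal_add (by positivity) (by positivity)]
      refine ENNReal.ofReal_le_ofReal ?_
      rw [h2, Complex.mul_conj, Complex.mul_conj, Complex.normSq_eq_norm_sq,
        Complex.normSq_eq_norm_sq, ← Complex.ofReal_sub, Complex.norm_real, Real.norm_eq_abs]
      linarith [le_abs_self (‖f x‖ ^ 2 - ‖f y‖ ^ 2)]
    refine h3.trans (add_le_add le_rfl ?_)
    rw [← ofReal_norm, intervalIntegral.norm_intervalIntegral_eq, ofReal_norm]
    refine (enorm_integral_le_lintegral_enorm _).trans (lintegral_mono_set ?_)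
    exact Set.uIoc_subset_uIcc.trans (Set.uIcc_subset_Icc hy hx)
  have hvol : volume J = 1 := by simp [hJ]
  have h4 : ENNReal.ofReal (‖f x‖ ^ 2) ≤
      (∫⁻ y in J, ENNReal.ofReal (‖f y‖ ^ 2)) + ∫⁻ t in J, ‖q t‖ₑ := by
    calc ENNReal.ofReal (‖f x‖ ^ 2) = ∫⁻ _ in J, ENNReal.ofReal (‖f x‖ ^ 2) := by
          rw [setLIntegral_const, hvol, mul_one]
      _ ≤ ∫⁻ y in J, (ENNReal.ofReal (‖f y‖ ^ 2) + ∫⁻ t in J, ‖q t‖ₑ) :=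
          setLIntegral_mono' measurableSet_Icc h1
      _ = _ := by rw [lintegral_add_left hmf, setLIntegral_const, hvol, mul_one]
  refine h4.trans ?_
  rw [← lintegral_add_left hmf]
  refine lintegral_mono fun y => ?_
  rw [← ofReal_norm, ← ENNReal.ofReal_add (by positivity) (by positivity)]
  refine ENNReal.ofReal_le_ofReal ?_
  have h5 : ‖q y‖ ≤ 2 * (‖p y‖ * ‖f y‖) := by
    refine (norm_add_le _ _).trans (le_of_eq ?_)
    rw [norm_mul, norm_mul, RCLike.norm_conj, RCLike.norm_conj]
    ring
  have h6 : 2 * (‖p y‖ * ‖f y‖) ≤ ε * ‖p y‖ ^ 2 + ε⁻¹ * ‖f y‖ ^ 2 := by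
    have h7 : 0 ≤ ε⁻¹ * (ε * ‖p y‖ - ‖f y‖) ^ 2 := by positivity
    have h8 : ε⁻¹ * (ε * ‖p y‖ - ‖f y‖) ^ 2 =
        ε * ‖p y‖ ^ 2 + ε⁻¹ * ‖f y‖ ^ 2 - 2 * (‖p y‖ * ‖f y‖) := by
      field_simp
      ring
    linarith
  unfold energy
  linarith

theorem aemeasurable_energy {f p : ℝ → ℂ} (h : IsPrimitive f p) (ε : ℝ) :
    AEMeasurable (energy ε f p) volume := by
  have h1 : AEMeasurable (fun y => ‖f y‖) volume := h.continuous.norm.aemeasurable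
  have h2 : AEMeasurable (fun y => ‖p y‖) volume :=
    h.locInt.aestronglyMeasurable.norm.aemeasurable
  exact ((h1.pow_const 2).const_mul _).add ((h2.pow_const 2).const_mul _)

/-- The form bound for `V` on a set `S` in which each point belongs to a unit interval. -/
theorem IsPrimitive.lintegral_potential_le {f p : ℝ → ℂ} (h : IsPrimitive f p) {V : ℝ → ℝ}
    (hV : LocallyIntegrable V volume) {M : ℝ} (hM : ∀ y, ∫ s in y..(y + 1), |V s| ≤ M)
    {ε : ℝ} (hε : 0 < ε) {S : Set ℝ} (hS : MeasurableSet S)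
    (hS' : ∀ x ∈ S, ∃ α, x ∈ Set.Icc α (α + 1) ∧ Set.Icc α (α + 1) ⊆ S) :
    ∫⁻ x in S, ENNReal.ofReal (|V x| * ‖f x‖ ^ 2) ≤
      ENNReal.ofReal (2 * M) * ∫⁻ y in S, ENNReal.ofReal (energy ε f p y) := by
  set Φ : ℝ → ENNReal := fun y => ENNReal.ofReal (energy ε f p y) with hΦ
  have hΦm : AEMeasurable Φ volume := (aemeasurable_energy h ε).ennreal_ofReal
  have hVm : AEMeasurable (fun x => ENNReal.ofReal |V x|) volume :=
    hV.aestronglyMeasurable.norm.aemeasurable.ennreal_ofReal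
  -- The strip `|x - y| ≤ 1` contains all pairs from a common unit interval. Inserting its indicator
  -- permits Tonelli's theorem; for fixed `y` the `x`-integral of `|V|` then runs over two unit
  -- intervals, whence `2M`.
  set T : Set (ℝ × ℝ) := {z | z.1 ∈ Set.Icc (z.2 - 1) (z.2 + 1)} with hT
  have hTm : MeasurableSet T := by
    refine IsClosed.measurableSet ?_
    exact (isClosed_le (continuous_snd.sub continuous_const) continuous_fst).inter
      (isClosed_le continuous_fst (continuous_snd.add continuous_const))
  set χ : ℝ → ℝ → ENNReal := fun x y => T.indicator 1 (x, y) with hχ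
  have hχm : Measurable (Function.uncurry χ) := measurable_one.indicator hTm
  have hχ1 : ∀ x y, χ x y = (Set.Icc (y - 1) (y + 1)).indicator 1 x := fun x y => rfl
  calc ∫⁻ x in S, ENNReal.ofReal (|V x| * ‖f x‖ ^ 2)
      ≤ ∫⁻ x in S, ∫⁻ y in S, ENNReal.ofReal |V x| * (χ x y * Φ y) := by
        refine setLIntegral_mono' hS fun x hx => ?_
        rw [ENNReal.ofReal_mul (abs_nonneg _), lintegral_const_mul' _ _ ENNReal.ofReal_ne_top]
        gcongr
        obtain ⟨α, hα, hαS⟩ := hS' x hx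
        refine (h.sq_norm_le hε hα).trans ?_
        calc ∫⁻ y in Set.Icc α (α + 1), Φ y = ∫⁻ y in Set.Icc α (α + 1), χ x y * Φ y := by
              refine setLIntegral_congr_fun measurableSet_Icc fun y hy => ?_
              have hxy : x ∈ Set.Icc (y - 1) (y + 1) :=
                ⟨by linarith [hy.2, hα.1], by linarith [hy.1, hα.2]⟩
              rw [hχ1, Set.indicator_of_mem hxy, Pi.one_apply, one_mul]
          _ ≤ _ := lintegral_mono_set hαS
    _ = ∫⁻ y in S, ∫⁻ x in S, ENNReal.ofReal |V x| * (χ x y * Φ y) := by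
        refine lintegral_lintegral_swap ?_
        exact hVm.restrict.comp_fst.mul (hχm.aemeasurable.mul hΦm.restrict.comp_snd)
    _ ≤ ∫⁻ y in S, ENNReal.ofReal (2 * M) * Φ y := by
        refine lintegral_mono fun y => ?_
        calc ∫⁻ x in S, ENNReal.ofReal |V x| * (χ x y * Φ y)
            = ∫⁻ x in S, Φ y * (Set.Icc (y - 1) (y + 1)).indicator
                (fun x => ENNReal.ofReal |V x|) x := by
              refine lintegral_congr fun x => ?_
              rw [hχ1]
              by_cases hx : x ∈ Set.Icc (y - 1) (y + 1) <;> simp [hx, mul_comm]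
          _ = Φ y * ∫⁻ x in S, (Set.Icc (y - 1) (y + 1)).indicator
                (fun x => ENNReal.ofReal |V x|) x :=
              lintegral_const_mul' _ _ ENNReal.ofReal_ne_top
          _ ≤ Φ y * ∫⁻ x, (Set.Icc (y - 1) (y + 1)).indicator
                (fun x => ENNReal.ofReal |V x|) x := by
              gcongr
              exact Measure.restrict_le_self
          _ ≤ Φ y * ENNReal.ofReal (2 * M) := by
              rw [lintegral_indicator measurableSet_Icc]
              gcongr
              exact lintegral_Icc_le hV hM y
          _ = _ := mul_comm _ _
    _ = _ := lintegral_const_mul' _ _ ENNReal.ofReal_ne_top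

theorem integrable_energy {ε : ℝ} {f p : ℝ → ℂ} (hf : MemLp f 2 volume) (hp : MemLp p 2 volume) :
    Integrable (energy ε f p) :=
  ((hf.integrable_norm_pow two_ne_zero).const_mul _).add
    ((hp.integrable_norm_pow two_ne_zero).const_mul _)

theorem IsPrimitive.integrable_potential {f p : ℝ → ℂ} (h : IsPrimitive f p)
    (hf : MemLp f 2 volume) (hp : MemLp p 2 volume) {V : ℝ → ℝ}
    (hV : LocallyIntegrable V volume)
    (hlim : Tendsto (fun x : ℝ => ∫ s in x..(x + 1), |V s|) (cocompact ℝ) (𝓝 0)) :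
    Integrable fun x => |V x| * ‖f x‖ ^ 2 := by
  obtain ⟨M, -, hM⟩ := exists_forall_integral_le hV hlim
  have h1 := h.lintegral_potential_le hV hM one_pos MeasurableSet.univ fun x _ =>
    ⟨x, ⟨le_rfl, by linarith⟩, Set.subset_univ _⟩
  rw [Measure.restrict_univ] at h1
  refine ⟨hV.aestronglyMeasurable.norm.mul
    (h.continuous.norm.pow 2).aestronglyMeasurable, ?_⟩
  rw [hasFiniteIntegral_iff_ofReal (Eventually.of_forall fun x => by positivity)]
  refine h1.trans_lt (ENNReal.mul_lt_top ENNReal.ofReal_lt_top ?_)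
  exact (hasFiniteIntegral_iff_ofReal
    (Eventually.of_forall (energy_nonneg one_pos f p))).1 (integrable_energy hf hp).2

theorem integrable_potential_mul {V : ℝ → ℝ} (hV : LocallyIntegrable V volume) {f g : ℝ → ℂ}
    (hf : Continuous f) (hg : Continuous g) (hf' : Integrable fun x => |V x| * ‖f x‖ ^ 2)
    (hg' : Integrable fun x => |V x| * ‖g x‖ ^ 2) :
    Integrable fun x => (V x : ℂ) * f x * conj (g x) := by
  refine (hf'.add hg').mono ?_ (Eventually.of_forall fun x => ?_)
  · exact ((Complex.continuous_ofReal.comp_aestronglyMeasurable hV.aestronglyMeasurable).mul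
      hf.aestronglyMeasurable).mul (Complex.continuous_conj.comp hg).aestronglyMeasurable
  · rw [Pi.add_apply, norm_mul, norm_mul, Complex.norm_real, RCLike.norm_conj, Real.norm_eq_abs,
      Real.norm_of_nonneg (by positivity), ← mul_add, mul_assoc]
    gcongr
    nlinarith [sq_nonneg (‖f x‖ - ‖g x‖), norm_nonneg (f x), norm_nonneg (g x)]

/-- This local version of the form bound does not presuppose that `p` is square integrable, so it
can serve to prove just that. For `R ≥ 1`, the unit interval starting at `x` (if `x ≤ 0`) or ending
at `x` (if `x ≥ 0`) stays inside `[-R, R]`. -/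
theorem IsPrimitive.integral_potential_le {f p : ℝ → ℂ} (h : IsPrimitive f p)
    (hp : Continuous p) {V : ℝ → ℝ} (hV : LocallyIntegrable V volume) {M : ℝ} (hM0 : 0 ≤ M)
    (hM : ∀ y, ∫ s in y..(y + 1), |V s| ≤ M) {ε : ℝ} (hε : 0 < ε) {R : ℝ} (hR : 1 ≤ R) :
    ∫ x in (-R)..R, |V x| * ‖f x‖ ^ 2 ≤ 2 * M * ∫ y in (-R)..R, energy ε f p y := by
  have h1 := h.lintegral_potential_le hV hM hε (measurableSet_Icc (a := -R) (b := R))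
    fun x hx => by
      rcases le_total x 0 with h0 | h0
      · exact ⟨x, ⟨le_rfl, by linarith⟩, Set.Icc_subset_Icc hx.1 (by linarith)⟩
      · exact ⟨x - 1, ⟨by linarith, by linarith⟩,
          Set.Icc_subset_Icc (by linarith) (by linarith [hx.2])⟩
  have hc : Continuous (energy ε f p) := by
    have := h.continuous
    unfold energy
    fun_prop
  have hi : IntegrableOn (fun x => |V x| * ‖f x‖ ^ 2) (Set.Icc (-R) R) := by
    have h2 := (hV.integrableOn_isCompact (isCompact_Icc (a := -R) (b := R))).norm
    exact IntegrableOn.mul_continuousOn h2 (h.continuous.norm.pow 2).continuousOn isCompact_Icc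
  rw [intervalIntegral.integral_of_le (by linarith), intervalIntegral.integral_of_le (by linarith),
    ← integral_Icc_eq_integral_Ioc, ← integral_Icc_eq_integral_Ioc]
  rw [← ofReal_integral_eq_lintegral_ofReal hi (Eventually.of_forall fun x => by positivity),
    ← ofReal_integral_eq_lintegral_ofReal (hc.integrableOn_Icc)
      (Eventually.of_forall (energy_nonneg hε f p)), ← ENNReal.ofReal_mul (by positivity)] at h1
  refine (ENNReal.ofReal_le_ofReal_iff ?_).1 h1
  exact mul_nonneg (by positivity) (integral_nonneg (energy_nonneg hε f p))

/-! ### The graph of the maximal Schrödinger operator -/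

/-- The second derivative prescribed by the equation `τ_V f = g`. -/
def secondDeriv (b c : ℝ) (V : ℝ → ℝ) (f g : ℝ → ℂ) (x : ℝ) : ℂ :=
  ((c : ℂ) ^ 2)⁻¹ * (((b : ℂ) ^ 2 + V x) * f x - g x)

theorem locallyIntegrable_secondDeriv {b c : ℝ} {V : ℝ → ℝ} (hV : LocallyIntegrable V volume)
    {f g : ℝ → ℂ} (hf : Continuous f) (hg : LocallyIntegrable g volume) :
    LocallyIntegrable (secondDeriv b c V f g) volume := by
  have h1 : LocallyIntegrable (fun x => (V x : ℂ)) volume := fun x => by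
    obtain ⟨s, hs, hi⟩ := hV x
    exact ⟨s, hs, hi.ofReal⟩
  have h2 : LocallyIntegrable (fun _ : ℝ => (b : ℂ) ^ 2) volume := locallyIntegrable_const _
  exact locInt_continuous_mul
    ((locInt_mul_continuous (h2.add h1) hf).sub hg) continuous_const

/-- Since `c ≠ 0`, the equation `τ_V f = g` can be solved for `f''` and becomes a first-order system
of integral equations, which is stable under integration by parts. -/
theorem mem_schrodingerGraph_iff {b c : ℝ} (hc : 0 < c) {V : ℝ → ℝ}
    (hV : LocallyIntegrable V volume) {u g : L2} :
    (u, g) ∈ schrodingerGraph b c V ↔ ∃ f p : ℝ → ℂ, u =ᵐ[volume] f ∧ IsPrimitive f p ∧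
      IsPrimitive p (secondDeriv b c V f g) := by
  have hc' : (c : ℂ) ≠ 0 := by exact_mod_cast hc.ne'
  constructor
  · rintro ⟨f, hf, hu, hg⟩
    have hdc : Continuous (deriv f) := continuous_iff_continuousAt.2 fun x =>
      (hf.ac_deriv (x - 1) (x + 1)).continuousOn.continuousAt (by
        rw [Set.uIcc_of_le (by linarith)]
        exact Icc_mem_nhds (by linarith) (by linarith))
    refine ⟨f, deriv f, hu, .of_hasDerivAt hdc fun x => (hf.diff x).hasDerivAt,
      .of_ac (locallyIntegrable_secondDeriv hV hf.diff.continuous (locallyIntegrable_L2 g))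
        hf.ac_deriv ?_⟩
    filter_upwards [hf.ae_diff, hg] with x h1 h2
    convert! h1.hasDerivAt using 1
    simp only [secondDeriv]
    change g x = _ at h2
    rw [h2, tau]
    field_simp
    ring
  · rintro ⟨f, p, hu, hf, hp⟩
    have hd : deriv f = p := funext fun x => (hf.hasDerivAt hp.continuous x).deriv
    refine ⟨f, ⟨fun x => (hf.hasDerivAt hp.continuous x).differentiableAt, hf.ac,
      by rw [hd]; exact hp.ac⟩, hu, ?_⟩
    filter_upwards [hp.ae_hasDerivAt] with x hx
    rw [tau, hd, hx.deriv, secondDeriv]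
    field_simp
    ring

/-! ### Energy estimate: the maximal domain lies in `H¹(ℝ)` -/

theorem hasDerivAt_norm_sq {f p : ℝ → ℂ} {x : ℝ} (h : HasDerivAt f (p x) x) :
    HasDerivAt (fun y => ‖f y‖ ^ 2) (2 * (p x * conj (f x)).re) x := by
  have h1 := h.norm_sq
  convert! h1 using 2

/-- If the energy of `f` on `[-R, R]` is controlled by the growth of `‖f‖²` at the end points and
`f` is square integrable, then so is its derivative. -/
theorem memLp_of_energy_le {f p : ℝ → ℂ} (hf : IsPrimitive f p) (hp : Continuous p)
    (hf2 : MemLp f 2 volume) {K : ℝ} (hK : ∀ R, 1 ≤ R → ∫ x in (-R)..R, ‖p x‖ ^ 2 ≤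
      K + 2 * ((p R * conj (f R)).re - (p (-R) * conj (f (-R))).re)) :
    MemLp p 2 volume := by
  have hpi : ∀ α β, IntervalIntegrable (fun x => ‖p x‖ ^ 2) volume α β := fun α β =>
    (hp.norm.pow 2).intervalIntegrable α β
  refine (memLp_two_iff_integrable_sq_norm hp.aestronglyMeasurable).2 ?_
  have hbd : ∀ R, 1 ≤ R → ∫ x in (-R)..R, ‖p x‖ ^ 2 ≤ K + 1 := by
    by_contra! hcon
    obtain ⟨R₀, hR₀, hcon⟩ := hcon
    -- The boundary term in `hK` is exactly `m'`. If the energy exceeds `K + 1` at `R₀`, then it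
    -- does so beyond `R₀`, hence `m' ≥ 1` there and `m` grows at least linearly, contradicting its
    -- integrability.
    let m : ℝ → ℝ := fun R => ‖f R‖ ^ 2 + ‖f (-R)‖ ^ 2
    have hm : ∀ R, HasDerivAt m (2 * (p R * conj (f R)).re -
        2 * (p (-R) * conj (f (-R))).re) R := fun R => by
      have h1 := hasDerivAt_norm_sq (hf.hasDerivAt hp R)
      have h2 := (hasDerivAt_norm_sq (hf.hasDerivAt hp (-R))).comp R (hasDerivAt_neg R)
      exact (h1.add h2).congr_deriv (by ring)
    have hmd : ∀ R, R₀ ≤ R → 1 ≤ 2 * (p R * conj (f R)).re -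
        2 * (p (-R) * conj (f (-R))).re := fun R hR => by
      have h1 := hK R (hR₀.trans hR)
      have h2 : ∫ x in (-R₀)..R₀, ‖p x‖ ^ 2 ≤ ∫ x in (-R)..R, ‖p x‖ ^ 2 :=
        intervalIntegral.integral_mono_interval (by linarith) (by linarith) hR
          (Eventually.of_forall fun x => by positivity) (hpi _ _)
      linarith
    have hmono : MonotoneOn (fun R => m R - R) (Set.Ici R₀) := by
      refine monotoneOn_of_deriv_nonneg (convex_Ici R₀) ?_ ?_ ?_
      · exact fun x _ => ((hm x).sub (hasDerivAt_id x)).continuousAt.continuousWithinAt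
      · exact fun x _ => ((hm x).sub (hasDerivAt_id x)).differentiableAt.differentiableWithinAt
      · intro x hx
        rw [interior_Ici] at hx
        rw [((hm x).fun_sub (hasDerivAt_id' x)).deriv]
        linarith [hmd x (le_of_lt hx)]
    have hmi : Integrable m :=
      (hf2.integrable_norm_pow two_ne_zero).add (hf2.integrable_norm_pow two_ne_zero).comp_neg
    have h1 : Integrable ((Set.Ici (R₀ + 1)).indicator fun _ => (1 : ℝ)) := by
      refine hmi.mono ((measurable_const.indicator measurableSet_Ici).aestronglyMeasurable)
        (Eventually.of_forall fun x => ?_)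
      have hm0 : 0 ≤ m x := by positivity
      by_cases hx : x ∈ Set.Ici (R₀ + 1)
      · rw [Set.indicator_of_mem hx, norm_one, Real.norm_of_nonneg hm0]
        have hx' : R₀ + 1 ≤ x := hx
        have h2 := hmono (Set.self_mem_Ici) (show x ∈ Set.Ici R₀ from by
          change R₀ ≤ x
          linarith) (by linarith)
        have h3 : 0 ≤ m R₀ := by positivity
        simp only at h2
        linarith
      · rw [Set.indicator_of_notMem hx]
        simp
    rw [integrable_indicator_iff measurableSet_Ici] at h1
    have h2 := (integrableOn_const_iff (by simp)).1 h1
    simp at h2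
  refine integrable_of_intervalIntegral_norm_bounded (l := atTop) (a := fun R : ℝ => -R)
    (b := fun R => R) (K + 1) (fun R => (hp.norm.pow 2).integrableOn_Ioc)
    tendsto_neg_atTop_atBot tendsto_id ?_
  filter_upwards [eventually_ge_atTop 1] with R hR
  simpa using hbd R hR

/-- The domain of the maximal Schrödinger operator is contained in `H¹(ℝ)`. -/
theorem mem_H1_of_mem_schrodingerGraph {b c : ℝ} (hc : 0 < c) {V : ℝ → ℝ}
    (hV : LocallyIntegrable V volume)
    (hlim : Tendsto (fun x : ℝ => ∫ s in x..(x + 1), |V s|) (cocompact ℝ) (𝓝 0))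
    {u g : L2} (h : (u, g) ∈ schrodingerGraph b c V) : u ∈ H1 := by
  obtain ⟨f, p, hu, hf, hp⟩ := (mem_schrodingerGraph_iff hc hV).1 h
  obtain ⟨M, hM0, hM⟩ := exists_forall_integral_le hV hlim
  have hf2 : MemLp f 2 volume := (memLp_congr_ae hu).1 (Lp.memLp u)
  have hfc := hf.continuous
  have hpc := hp.continuous
  have hfi := hf2.integrable_norm_pow (two_ne_zero)
  have hgi := (Lp.memLp g).integrable_norm_pow (two_ne_zero)
  -- This makes the potential absorb at most half of the kinetic energy `c² ∫ |p|²`; `M + 1` avoids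
  -- division by zero.
  set ε : ℝ := c ^ 2 / (4 * (M + 1)) with hε
  have hε0 : 0 < ε := by positivity
  have hMε : 2 * M * ε ≤ c ^ 2 / 2 := by
    rw [hε, mul_div_assoc', div_le_div_iff₀ (by positivity) two_pos]
    nlinarith [sq_nonneg c]
  set K : ℝ := 2 * M * (1 + ε⁻¹) * (∫ x, ‖f x‖ ^ 2) + ((∫ x, ‖g x‖ ^ 2) + ∫ x, ‖f x‖ ^ 2) with hK
  have hp2 : MemLp p 2 volume := by
    -- The remaining half is divided out by `c²/2`, which also yields the factor `2` before the
    -- boundary term.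
    refine memLp_of_energy_le hf hpc hf2 (K := 2 / c ^ 2 * K) fun R hR => ?_
    have hRR : -R ≤ R := by linarith
    have h1 := hf.integral_potential_le hpc hV hM0 hM hε0 hR
    have hle : ∀ {φ : ℝ → ℝ}, Integrable φ → (∀ x, 0 ≤ φ x) →
        ∫ x in (-R)..R, φ x ≤ ∫ x, φ x := fun hφ hφ0 => by
      rw [intervalIntegral.integral_of_le hRR]
      exact setIntegral_le_integral hφ (Eventually.of_forall hφ0)
    have ip : IntervalIntegrable (fun x => ‖p x‖ ^ 2) volume (-R) R :=
      (hpc.norm.pow 2).intervalIntegrable _ _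
    have jf : IntervalIntegrable (fun x => ‖f x‖ ^ 2) volume (-R) R :=
      (hfc.norm.pow 2).intervalIntegrable _ _
    have jg : IntervalIntegrable (fun x => ‖g x‖ ^ 2) volume (-R) R := hgi.intervalIntegrable
    have jV : IntervalIntegrable (fun x => |V x| * ‖f x‖ ^ 2) volume (-R) R :=
      (locInt_interval hV (-R) R).norm.mul_continuousOn (hfc.norm.pow 2).continuousOn
    have h2 : ∫ y in (-R)..R, energy ε f p y =
        (1 + ε⁻¹) * (∫ x in (-R)..R, ‖f x‖ ^ 2) + ε * ∫ x in (-R)..R, ‖p x‖ ^ 2 := by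
      unfold energy
      rw [intervalIntegral.integral_add (jf.const_mul _) (ip.const_mul _),
        intervalIntegral.integral_const_mul, intervalIntegral.integral_const_mul]
    have hF := hp.mul hf.star
    have jF : IntervalIntegrable
        (fun x => (secondDeriv b c V f g x * conj (f x) + p x * conj (p x)).re)
        volume (-R) R :=
      ⟨(locInt_interval hF.locInt (-R) R).1.re, (locInt_interval hF.locInt (-R) R).2.re⟩
    have h3 := hF.sub_eq (-R) R
    have h4 : ∫ x in (-R)..R, ((secondDeriv b c V f g x * conj (f x) + p x * conj (p x)).re) =
        (p R * conj (f R)).re - (p (-R) * conj (f (-R))).re := by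
      rw [← Complex.sub_re, ← h3]
      exact Complex.reCLM.intervalIntegral_comp_comm (locInt_interval hF.locInt (-R) R)
    -- By the equation, `c²|p|² = c² Re (p f̄)' - (b² + V)|f|² + Re (g f̄)`; the term with `b²` has
    -- a favourable sign and is dropped.
    have h5 : ∫ x in (-R)..R, c ^ 2 * ‖p x‖ ^ 2 ≤ ∫ x in (-R)..R,
        (c ^ 2 * (secondDeriv b c V f g x * conj (f x) + p x * conj (p x)).re +
          (|V x| * ‖f x‖ ^ 2 + (‖g x‖ ^ 2 + ‖f x‖ ^ 2))) := by
      refine intervalIntegral.integral_mono_on hRR (ip.const_mul _)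
        ((jF.const_mul _).add (jV.add (jg.add jf))) fun x _ => ?_
      have e1 : c ^ 2 * (secondDeriv b c V f g x * conj (f x) + p x * conj (p x)).re =
          (b ^ 2 + V x) * ‖f x‖ ^ 2 - (g x * conj (f x)).re + c ^ 2 * ‖p x‖ ^ 2 := by
        have e2 : (c : ℂ) ^ 2 * (secondDeriv b c V f g x * conj (f x) + p x * conj (p x)) =
            ((b : ℂ) ^ 2 + V x) * (f x * conj (f x)) - g x * conj (f x) +
              (c : ℂ) ^ 2 * (p x * conj (p x)) := by
          have hc' : (c : ℂ) ≠ 0 := by exact_mod_cast hc.ne'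
          unfold secondDeriv
          field_simp
        have e3 := congrArg Complex.re e2
        rw [Complex.mul_conj, Complex.mul_conj, Complex.normSq_eq_norm_sq,
          Complex.normSq_eq_norm_sq] at e3
        rw [Complex.mul_conj, Complex.normSq_eq_norm_sq]
        simp only [← Complex.ofReal_pow, ← Complex.ofReal_add, ← Complex.ofReal_mul,
          Complex.add_re, Complex.sub_re, Complex.re_ofReal_mul, Complex.ofReal_re] at e3 ⊢
        linarith
      have e4 : (g x * conj (f x)).re ≤ ‖g x‖ ^ 2 + ‖f x‖ ^ 2 := by
        refine (Complex.re_le_norm _).trans ?_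
        rw [norm_mul, RCLike.norm_conj]
        nlinarith [sq_nonneg (‖g x‖ - ‖f x‖), norm_nonneg (g x), norm_nonneg (f x)]
      have e5 : -(|V x| * ‖f x‖ ^ 2) ≤ V x * ‖f x‖ ^ 2 := by
        rw [← neg_mul]
        exact mul_le_mul_of_nonneg_right (neg_abs_le _) (by positivity)
      have e6 : 0 ≤ b ^ 2 * ‖f x‖ ^ 2 := by positivity
      linarith
    rw [intervalIntegral.integral_add (jF.const_mul _) (jV.add (jg.add jf)),
      intervalIntegral.integral_add jV (jg.add jf), intervalIntegral.integral_add jg jf,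
      intervalIntegral.integral_const_mul, intervalIntegral.integral_const_mul, h4] at h5
    rw [h2] at h1
    have hfl := hle hfi fun x => by positivity
    have hgl := hle hgi fun x => by positivity
    have hP0 : 0 ≤ ∫ x in (-R)..R, ‖p x‖ ^ 2 :=
      intervalIntegral.integral_nonneg hRR fun x _ => by positivity
    have h6 : 2 * M * ((1 + ε⁻¹) * (∫ x in (-R)..R, ‖f x‖ ^ 2) +
        ε * ∫ x in (-R)..R, ‖p x‖ ^ 2) ≤ 2 * M * (1 + ε⁻¹) * (∫ x, ‖f x‖ ^ 2) +
          c ^ 2 / 2 * ∫ x in (-R)..R, ‖p x‖ ^ 2 := by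
      have := mul_le_mul_of_nonneg_right hMε hP0
      have := mul_le_mul_of_nonneg_left hfl (show 0 ≤ 2 * M * (1 + ε⁻¹) by positivity)
      linarith
    have h7 : c ^ 2 / 2 * (∫ x in (-R)..R, ‖p x‖ ^ 2) ≤
        K + c ^ 2 * ((p R * conj (f R)).re - (p (-R) * conj (f (-R))).re) := by
      rw [hK]
      linarith
    have h8 := mul_le_mul_of_nonneg_left h7 (show 0 ≤ 2 / c ^ 2 by positivity)
    have h9 : 2 / c ^ 2 * (c ^ 2 / 2 * ∫ x in (-R)..R, ‖p x‖ ^ 2) =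
        ∫ x in (-R)..R, ‖p x‖ ^ 2 := by
      field_simp
    rw [h9] at h8
    refine h8.trans (le_of_eq ?_)
    field_simp
  obtain ⟨hu', -⟩ := mem_H1_of_isPrimitive (w := hp2.toLp p) hu
    (hf.congr_ae hp2.coeFn_toLp.symm)
  exact hu'

/-! ### The form `𝔱_V` and the maximal operator -/

theorem memLp_of_ae_eq {u : L2} {f : ℝ → ℂ} (h : u =ᵐ[volume] f) : MemLp f 2 volume :=
  (memLp_congr_ae h).1 (Lp.memLp u)

theorem inner_D_D (u v : H1) : inner ℂ (D v) (D u) =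
    ∫ x, (Complex.I • D u : L2) x * conj ((Complex.I • D v : L2) x) := by
  rw [← inner_L2_eq, inner_smul_left, inner_smul_right, ← mul_assoc, Complex.conj_I,
    neg_mul, Complex.I_mul_I, neg_neg, one_mul]

/-- Integrate `(u' v̄)' = u'' v̄ + u' v̄'` over the line: the left side contributes zero, and `u''`
is replaced from the equation. The form bound for `u` and `v` separately makes `V u v̄` integrable.
-/
theorem tV_eq_of_mem_schrodingerGraph {b c : ℝ} (hc : 0 < c) {V : ℝ → ℝ}
    (hV : LocallyIntegrable V volume)
    (hlim : Tendsto (fun x : ℝ => ∫ s in x..(x + 1), |V s|) (cocompact ℝ) (𝓝 0))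
    {u : H1} {g : L2} (h : ((u : L2), g) ∈ schrodingerGraph b c V) (v : H1) :
    Integrable (fun x => (V x : ℂ) * (u : L2) x * conj ((v : L2) x)) ∧
      tV b c V u v = inner ℂ (v : L2) g := by
  obtain ⟨f, p, hu, hf, hp⟩ := (mem_schrodingerGraph_iff hc hV).1 h
  obtain ⟨f', hu', hf'⟩ := exists_isPrimitive_of_H1 u
  obtain ⟨k, hv, hk⟩ := exists_isPrimitive_of_H1 v
  have hff : f' = f := (Continuous.ae_eq_iff_eq volume hf'.continuous hf.continuous).1
    (hu'.symm.trans hu)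
  subst hff
  have hpD : (Complex.I • D u : L2) =ᵐ[volume] p := by
    filter_upwards [hf.ae_hasDerivAt, hf'.ae_hasDerivAt] with x h1 h2
    exact h2.unique h1
  set q : L2 := Complex.I • D v with hq
  have iVf := hf.integrable_potential (memLp_of_ae_eq hu) (memLp_of_ae_eq hpD) hV hlim
  have iVk := hk.integrable_potential (memLp_of_ae_eq hv) (Lp.memLp q) hV hlim
  have iV := integrable_potential_mul hV hf.continuous hk.continuous iVf iVk
  have eV : (fun x => (V x : ℂ) * (u : L2) x * conj ((v : L2) x)) =ᵐ[volume]
      fun x => (V x : ℂ) * f' x * conj (k x) := by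
    filter_upwards [hu, hv] with x h1 h2
    rw [h1, h2]
  refine ⟨iV.congr eV.symm, ?_⟩
  have ifk : Integrable fun x => f' x * conj (k x) := by
    refine (integrable_mul_conj (u : L2) (v : L2)).congr ?_
    filter_upwards [hu, hv] with x h1 h2
    rw [h1, h2]
  have igk : Integrable fun x => g x * conj (k x) := by
    refine (integrable_mul_conj g (v : L2)).congr ?_
    filter_upwards [hv] with x h2
    rw [h2]
  have ipq : Integrable fun x => p x * conj (q x) := by
    refine (integrable_mul_conj (Complex.I • D u) q).congr ?_
    filter_upwards [hpD] with x h1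
    rw [h1]
  have ipk : Integrable fun x => p x * conj (k x) := by
    refine (integrable_mul_conj (Complex.I • D u) (v : L2)).congr ?_
    filter_upwards [hpD, hv] with x h1 h2
    rw [h1, h2]
  have es : (fun x => secondDeriv b c V f' g x * conj (k x)) = fun x => ((c : ℂ) ^ 2)⁻¹ *
      ((b : ℂ) ^ 2 * (f' x * conj (k x)) + (V x : ℂ) * f' x * conj (k x) - g x * conj (k x)) := by
    ext x
    unfold secondDeriv
    ring
  have is : Integrable fun x => secondDeriv b c V f' g x * conj (k x) := by
    rw [es]
    exact (((ifk.const_mul _).add iV).sub igk).const_mul _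
  have key := (hp.mul hk.star).integral_eq_zero ipk (is.add ipq)
  rw [integral_add is ipq, es, integral_const_mul, integral_sub ((ifk.const_mul _).fun_add iV) igk,
    integral_add (ifk.const_mul _) iV, integral_const_mul] at key
  have e1 : inner ℂ (D v) (D u) = ∫ x, p x * conj (q x) := by
    rw [inner_D_D]
    refine integral_congr_ae ?_
    filter_upwards [hpD] with x h1
    rw [h1]
  have e2 : inner ℂ (v : L2) (u : L2) = ∫ x, f' x * conj (k x) := by
    rw [inner_L2_eq]
    refine integral_congr_ae ?_
    filter_upwards [hu, hv] with x h1 h2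
    rw [h1, h2]
  have e3 : inner ℂ (v : L2) g = ∫ x, g x * conj (k x) := by
    rw [inner_L2_eq]
    refine integral_congr_ae ?_
    filter_upwards [hv] with x h2
    rw [h2]
  rw [tV, e1, e2, e3, integral_congr_ae eV]
  have hc' : (c : ℂ) ≠ 0 := by exact_mod_cast hc.ne'
  field_simp at key
  linear_combination key

/-- Restricted to test functions, the form equation says that `u'` has the locally integrable weak
derivative prescribed by `secondDeriv`, so `u'` agrees almost everywhere with a primitive of it. -/
theorem mem_schrodingerGraph_of_tV_eq {b c : ℝ} (hc : 0 < c) {V : ℝ → ℝ}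
    (hV : LocallyIntegrable V volume) {u : H1} {g : L2}
    (h : ∀ v : H1, Integrable (fun x => (V x : ℂ) * (u : L2) x * conj ((v : L2) x)) ∧
      tV b c V u v = inner ℂ (v : L2) g) :
    ((u : L2), g) ∈ schrodingerGraph b c V := by
  have hc' : (c : ℂ) ≠ 0 := by exact_mod_cast hc.ne'
  obtain ⟨f, hu, hf⟩ := exists_isPrimitive_of_H1 u
  set p : L2 := Complex.I • D u with hp
  obtain ⟨p', hp', hpp⟩ := exists_isPrimitive_of_weak (locallyIntegrable_L2 p)
    (locallyIntegrable_secondDeriv (b := b) (c := c) hV hf.continuous (locallyIntegrable_L2 g))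
    fun φ hφ hφ' => by
      have hφd : Continuous (deriv φ) := hφ.continuous_deriv (by norm_num)
      have hm : MemLp (fun x => (φ x : ℂ)) 2 volume :=
        (Complex.continuous_ofReal.comp hφ.continuous).memLp_of_hasCompactSupport
          (hφ'.comp_left Complex.ofReal_zero)
      have hm' : MemLp (fun x => ((deriv φ x : ℝ) : ℂ)) 2 volume :=
        (Complex.continuous_ofReal.comp hφd).memLp_of_hasCompactSupport
          (hφ'.deriv.comp_left Complex.ofReal_zero)
      have hφp : IsPrimitive (fun x => (φ x : ℂ)) fun x => ((deriv φ x : ℝ) : ℂ) :=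
        IsPrimitive.of_hasDerivAt (Complex.continuous_ofReal.comp hφd) fun x =>
          ((hφ.differentiable (by norm_num) x).hasDerivAt).ofReal_comp
      obtain ⟨hv, hD⟩ := mem_H1_of_isPrimitive hm.coeFn_toLp
        (hφp.congr_ae hm'.coeFn_toLp.symm)
      obtain ⟨iV, ht⟩ := h ⟨_, hv⟩
      have hD' : Complex.I • D ⟨_, hv⟩ = hm'.toLp _ := by
        rw [hD, smul_smul, mul_neg, Complex.I_mul_I, neg_neg, one_smul]
      rw [tV, inner_D_D, hD', inner_L2_eq, inner_L2_eq] at ht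
      have eV : (fun x => (V x : ℂ) * (u : L2) x * conj ((hm.toLp _ : L2) x)) =ᵐ[volume]
          fun x => φ x • ((V x : ℂ) * f x) := by
        filter_upwards [hu, hm.coeFn_toLp] with x h1 h2
        rw [h1, h2, Complex.conj_ofReal, Complex.real_smul]
        ring
      have e1 : ∫ x, p x * conj ((hm'.toLp _ : L2) x) = ∫ x, deriv φ x • p x := by
        refine integral_congr_ae ?_
        filter_upwards [hm'.coeFn_toLp] with x h2
        rw [h2, Complex.conj_ofReal, Complex.real_smul, mul_comm]
      have e2 : ∫ x, (u : L2) x * conj ((hm.toLp _ : L2) x) = ∫ x, φ x • f x := by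
        refine integral_congr_ae ?_
        filter_upwards [hu, hm.coeFn_toLp] with x h1 h2
        rw [h1, h2, Complex.conj_ofReal, Complex.real_smul, mul_comm]
      have e3 : ∫ x, g x * conj ((hm.toLp _ : L2) x) = ∫ x, φ x • g x := by
        refine integral_congr_ae ?_
        filter_upwards [hm.coeFn_toLp] with x h2
        rw [h2, Complex.conj_ofReal, Complex.real_smul, mul_comm]
      rw [e1, e2, e3, integral_congr_ae eV] at ht
      have if' := integrable_smul_of_hasCompactSupport hφ.continuous hφ'
        hf.continuous.locallyIntegrable
      have ig := integrable_smul_of_hasCompactSupport hφ.continuous hφ' (locallyIntegrable_L2 g)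
      have es : (fun x => φ x • secondDeriv b c V f g x) = fun x => ((c : ℂ) ^ 2)⁻¹ *
          ((b : ℂ) ^ 2 * (φ x • f x) + φ x • ((V x : ℂ) * f x) - φ x • g x) := by
        ext x
        simp only [secondDeriv, Complex.real_smul]
        ring
      rw [es, integral_const_mul, integral_sub ((if'.const_mul _).fun_add (iV.congr eV)) ig,
        integral_add (if'.const_mul _) (iV.congr eV), integral_const_mul, ← ht]
      field_simp
      ring
  exact (mem_schrodingerGraph_iff hc hV).2 ⟨f, p', hu, hf.congr_ae hpp, hp'⟩

/-! ### The operator `𝒥` and the form of `D` -/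

theorem sign_mul_sign {ξ : ℝ} (h : ξ ≠ 0) : Real.sign ξ * Real.sign ξ = 1 := by
  rcases Real.sign_apply_eq_of_ne_zero ξ h with h | h <;> simp [h]

theorem J₀_J₀ (u : HHalf) : J₀ (J₀ u) = u := by
  apply toL2_injective
  apply fourier_injective
  refine Lp.ext ?_
  filter_upwards [fourier_J₀ (J₀ u), fourier_J₀ u, ae_ne_zero] with ξ h1 h2 h3
  rw [h1, h2, ← mul_assoc, ← Complex.ofReal_mul, sign_mul_sign h3, Complex.ofReal_one, one_mul]

/-- The symbol `sgn²` equals one off a null set; density of `H^{1/2}` and continuity do the rest. -/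
theorem J_J (U : HDot) : J (J U) = U :=
  denseRange_toHDot.induction_on (p := fun U => J (J U) = U) U
    (isClosed_eq (J.continuous.comp J.continuous) continuous_id)
    fun u => by rw [J_toHDot, J_toHDot, J₀_J₀]

/-- The two factors `|λ|^{1/2}` of the homogeneous inner product combine with `sgn λ` to the symbol
`λ` of `D`. This is the bridge between the two Hilbert spaces. -/
theorem inner_toHDot_J (v w : H1) :
    inner ℂ (H1.toHDot v) (J (H1.toHDot w)) = inner ℂ (v : L2) (D w) := by
  have h1 : J (H1.toHDot w) = toHDot (J₀ (H1.toHHalf w)) := J_toHDot _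
  have h2 : H1.toHDot v = toHDot (H1.toHHalf v) := rfl
  rw [h1, h2, LinearIsometry.inner_map_map, inner_HHalf, inner_eq_inner_fourier,
    inner_eq_inner_fourier (v : L2), L2.inner_def, L2.inner_def]
  refine integral_congr_ae ?_
  filter_upwards [fourier_sqrtAbsD (H1.toHHalf v), fourier_sqrtAbsD (J₀ (H1.toHHalf w)),
    fourier_J₀ (H1.toHHalf w), fourier_D w] with ξ e1 e2 e3 e4
  rw [e1, e2, e3, e4, toL2_toHHalf, toL2_toHHalf]
  simp only [RCLike.inner_apply, map_mul, Complex.conj_ofReal]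
  have e5 : |2 * Real.pi * ξ| ^ (1 / 2 : ℝ) * |2 * Real.pi * ξ| ^ (1 / 2 : ℝ) * Real.sign ξ =
      2 * Real.pi * ξ := by
    rw [← Real.sqrt_eq_rpow, Real.mul_self_sqrt (abs_nonneg _), abs_mul,
      abs_of_pos (by positivity : 0 < 2 * Real.pi), mul_assoc]
    congr 1
    rcases lt_trichotomy ξ 0 with h | h | h
    · rw [abs_of_neg h, Real.sign_of_neg h]
      ring
    · simp [h]
    · rw [abs_of_pos h, Real.sign_of_pos h, mul_one]
  have e6 : ((2 * Real.pi * ξ : ℝ) : ℂ) = ((|2 * Real.pi * ξ| ^ (1 / 2 : ℝ) : ℝ) : ℂ) *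
      ((|2 * Real.pi * ξ| ^ (1 / 2 : ℝ) : ℝ) : ℂ) * ((Real.sign ξ : ℝ) : ℂ) := by
    rw [← Complex.ofReal_mul, ← Complex.ofReal_mul, e5]
  rw [e6]
  ring

theorem H1.toHDot_injective : Function.Injective H1.toHDot :=
  HamKrein.toHDot.injective.comp (Submodule.inclusion_injective H1_le)

/-- `ℒ u = 𝒥 w` for elements `u`, `w` of `H¹(ℝ)` if and only if `H_V u = D w`. -/
theorem mem_formGraph_iff {b c : ℝ} (hc : 0 < c) {V : ℝ → ℝ} (hV : LocallyIntegrable V volume)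
    (hlim : Tendsto (fun x : ℝ => ∫ s in x..(x + 1), |V s|) (cocompact ℝ) (𝓝 0)) (u w : H1) :
    (H1.toHDot u, J (H1.toHDot w)) ∈ formGraph b c V ↔
      ((u : L2), D w) ∈ schrodingerGraph b c V := by
  constructor
  · rintro ⟨u', hu, h⟩
    obtain rfl := H1.toHDot_injective hu
    exact mem_schrodingerGraph_of_tV_eq hc hV fun v =>
      ⟨(h v).1, (h v).2.trans (inner_toHDot_J v w)⟩
  · intro h
    refine ⟨u, rfl, fun v => ?_⟩
    obtain ⟨h1, h2⟩ := tV_eq_of_mem_schrodingerGraph hc hV hlim h v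
    exact ⟨h1, h2.trans (inner_toHDot_J v w).symm⟩

/-! ### Iterated kernels -/

/-- A single recursion covers the separately defined first kernel, where `y = 0`, and all later
ones. The form `H_V u = D(zu + y)` is the one to which `mem_formGraph_iff` applies. -/
theorem mem_kerHVPow_succ {b c : ℝ} {V : ℝ → ℝ} {z : ℂ} {n : ℕ} {x : L2} :
    x ∈ kerHVPow b c V z (n + 1) ↔ ∃ u y : H1, (u : L2) = x ∧ (y : L2) ∈ kerHVPow b c V z n ∧
      ((u : L2), D (z • u + y)) ∈ schrodingerGraph b c V := by
  have key : ∀ (u : H1) (g : L2), ((u : L2), z • D u + g) ∈ schrodingerGraph b c V ↔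
      ∃ h : (u : L2) ∈ (HV b c V - z • D).domain, (HV b c V - z • D) ⟨u, h⟩ = g := by
    intro u g
    rw [← HV_graph, LinearPMap.mem_graph_iff]
    constructor
    · rintro ⟨w, hw, hw'⟩
      change (w : L2) = u at hw
      have hu : (u : L2) ∈ (HV b c V).domain := hw ▸ w.2
      refine ⟨⟨hu, u.2⟩, ?_⟩
      have hw2 : w = ⟨u, hu⟩ := Subtype.ext hw
      subst hw2
      rw [LinearPMap.sub_apply, LinearPMap.smul_apply]
      exact sub_eq_iff_eq_add'.2 hw'
    · rintro ⟨h, h'⟩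
      refine ⟨⟨u, h.1⟩, rfl, ?_⟩
      rw [LinearPMap.sub_apply, LinearPMap.smul_apply] at h'
      exact sub_eq_iff_eq_add'.1 h'
  cases n with
  | zero =>
    change x ∈ pker _ ↔ _
    rw [mem_pker]
    constructor
    · rintro ⟨h, h'⟩
      refine ⟨⟨x, h.2⟩, 0, rfl, Submodule.zero_mem _, ?_⟩
      have h1 := (key ⟨x, h.2⟩ 0).2 ⟨h, h'⟩
      rw [add_zero] at h1
      rw [add_zero, LinearPMap.map_smul]
      exact h1
    · rintro ⟨u, y, rfl, hy, h⟩
      have hy0 : y = 0 := Subtype.ext ((Submodule.mem_bot ℂ).1 hy)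
      rw [hy0, add_zero, LinearPMap.map_smul] at h
      exact (key u 0).1 (by rwa [add_zero])
  | succ n =>
    constructor
    · rintro ⟨⟨_, h⟩, ⟨y, hy, hy'⟩, rfl⟩
      refine ⟨⟨_, h.2⟩, y, rfl, hy, ?_⟩
      rw [LinearPMap.map_add, LinearPMap.map_smul]
      exact (key ⟨_, h.2⟩ (D y)).2 ⟨h, hy'.symm⟩
    · rintro ⟨u, y, rfl, hy, h⟩
      rw [LinearPMap.map_add, LinearPMap.map_smul] at h
      obtain ⟨h1, h2⟩ := (key u (D y)).1 h
      exact ⟨⟨u, h1⟩, ⟨y, hy, h2.symm⟩, rfl⟩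

theorem mem_kerAPow_zero {b c : ℝ} {V : ℝ → ℝ} {z : ℂ} {U : HDot} :
    U ∈ kerAPow b c V z 0 ↔ U = 0 := by
  rw [kerAPow, mem_pker]
  exact ⟨fun ⟨_, h⟩ => h, fun h => ⟨Submodule.mem_top, h⟩⟩

theorem mem_kerAPow_succ {b c : ℝ} {V : ℝ → ℝ} {z : ℂ} {n : ℕ} {U : HDot} :
    U ∈ kerAPow b c V z (n + 1) ↔
      ∃ W, (U, W) ∈ formGraph b c V ∧ J W - z • U ∈ kerAPow b c V z n := by
  rw [← calL_graph, kerAPow, mem_pker]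
  constructor
  · rintro ⟨h, h'⟩
    obtain ⟨h1, h2⟩ := mem_pcomp_domain.1 h
    refine ⟨calL b c V ⟨U, h1.1⟩, (calL b c V).mem_graph ⟨U, h1.1⟩, ?_⟩
    exact mem_pker.2 ⟨h2, h'⟩
  · rintro ⟨W, hW, h⟩
    rw [LinearPMap.mem_graph_iff] at hW
    obtain ⟨⟨U', hU⟩, rfl, rfl⟩ := hW
    obtain ⟨h2, h3⟩ := mem_pker.1 h
    exact ⟨mem_pcomp_domain.2 ⟨⟨hU, Submodule.mem_top⟩, h2⟩, h3⟩

theorem mem_kerL {b c : ℝ} {V : ℝ → ℝ} {z : ℂ} {U : HDot} :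
    U ∈ kerL b c V z ↔ (U, z • J U) ∈ formGraph b c V := by
  rw [← calL_graph, kerL, mem_pker, LinearPMap.mem_graph_iff]
  constructor
  · rintro ⟨h, h'⟩
    exact ⟨⟨U, h.1⟩, rfl, sub_eq_zero.1 h'⟩
  · rintro ⟨⟨U', hU⟩, rfl, h⟩
    exact ⟨⟨hU, Submodule.mem_top⟩, sub_eq_zero.2 h⟩

/-- `S` and `T` are one and the same set of elements of `H¹(ℝ)`. -/
def CoincideH1 (S : Set L2) (T : Set HDot) : Prop :=
  S ⊆ H1 ∧ ∀ U, U ∈ T ↔ ∃ u : H1, H1.toHDot u = U ∧ (u : L2) ∈ S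

theorem CoincideH1.coincide {S : Set L2} {T : Set HDot} (h : CoincideH1 S T) : Coincide S T := by
  refine ⟨toL2 ⁻¹' S, ?_, ?_⟩
  · refine Set.image_preimage_eq_of_subset fun x hx => ?_
    exact ⟨H1.toHHalf ⟨x, h.1 hx⟩, rfl⟩
  · ext U
    rw [h.2]
    constructor
    · rintro ⟨x, hx, rfl⟩
      exact ⟨⟨toL2 x, h.1 hx⟩, rfl, hx⟩
    · rintro ⟨u, rfl, hu⟩
      exact ⟨H1.toHHalf u, hu, rfl⟩

theorem CoincideH1.iUnion {S : ℕ → Set L2} {T : ℕ → Set HDot}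
    (h : ∀ n, CoincideH1 (S n) (T n)) : CoincideH1 (⋃ n, S n) (⋃ n, T n) := by
  refine ⟨Set.iUnion_subset fun n => (h n).1, fun U => ?_⟩
  simp only [Set.mem_iUnion, (h _).2]
  exact ⟨fun ⟨n, u, h1, h2⟩ => ⟨u, h1, n, h2⟩, fun ⟨u, h1, n, h2⟩ => ⟨n, u, h1, h2⟩⟩

/-- The induction carries `CoincideH1` rather than `Coincide`: the vector `y = (𝒜 - z)u` must be
known to lie in `H¹` before `D(zu + y)` makes sense. -/
theorem coincideH1_kerPow {b c : ℝ} (hc : 0 < c) {V : ℝ → ℝ} (hV : LocallyIntegrable V volume)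
    (hlim : Tendsto (fun x : ℝ => ∫ s in x..(x + 1), |V s|) (cocompact ℝ) (𝓝 0)) (z : ℂ)
    (n : ℕ) : CoincideH1 (kerHVPow b c V z n) (kerAPow b c V z n) := by
  induction n with
  | zero =>
    refine ⟨fun x hx => ?_, fun U => ?_⟩
    · rw [(Submodule.mem_bot ℂ).1 hx]
      exact Submodule.zero_mem _
    · rw [SetLike.mem_coe, mem_kerAPow_zero]
      constructor
      · rintro rfl
        exact ⟨0, map_zero _, Submodule.zero_mem _⟩
      · rintro ⟨u, rfl, hu⟩
        have hu0 : u = 0 := Subtype.ext ((Submodule.mem_bot ℂ).1 hu)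
        rw [hu0, map_zero]
  | succ n ih =>
    refine ⟨fun x hx => ?_, fun U => ?_⟩
    · obtain ⟨u, -, rfl, -⟩ := mem_kerHVPow_succ.1 hx
      exact u.2
    · rw [SetLike.mem_coe, mem_kerAPow_succ]
      constructor
      · rintro ⟨W, hW, hn⟩
        obtain ⟨y, hy, hy'⟩ := (ih.2 _).1 hn
        obtain ⟨u, hu, -⟩ := id hW
        change H1.toHDot u = U at hu
        subst hu
        -- From `𝒥W - zu = y` and `𝒥² = 1`.
        have hW' : W = J (H1.toHDot (z • u + y)) := by
          rw [map_add, map_smul, hy, add_sub_cancel, J_J]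
        rw [hW', mem_formGraph_iff hc hV hlim] at hW
        exact ⟨u, rfl, mem_kerHVPow_succ.2 ⟨u, y, rfl, hy', hW⟩⟩
      · rintro ⟨u', rfl, hu⟩
        obtain ⟨u, y, hu', hy, h⟩ := mem_kerHVPow_succ.1 hu
        obtain rfl : u = u' := Subtype.ext hu'
        refine ⟨J (H1.toHDot (z • u + y)), (mem_formGraph_iff hc hV hlim _ _).2 h, ?_⟩
        rw [J_J, map_add, map_smul, add_sub_cancel_left]
        exact (ih.2 _).2 ⟨y, rfl, hy⟩

/-- This is the case `n = 1`, because `ℒu = z𝒥u` and `𝒥ℒu = zu` are equivalent by `𝒥² = 1`. -/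
theorem coincideH1_ker {b c : ℝ} (hc : 0 < c) {V : ℝ → ℝ} (hV : LocallyIntegrable V volume)
    (hlim : Tendsto (fun x : ℝ => ∫ s in x..(x + 1), |V s|) (cocompact ℝ) (𝓝 0)) (z : ℂ) :
    CoincideH1 (kerHV b c V z) (kerL b c V z) := by
  have h1 := coincideH1_kerPow (b := b) hc hV hlim z 1
  refine ⟨h1.1, fun U => (Iff.trans ?_ (h1.2 U))⟩
  rw [SetLike.mem_coe, SetLike.mem_coe, mem_kerL, mem_kerAPow_succ]
  simp only [mem_kerAPow_zero, sub_eq_zero]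
  constructor
  · exact fun h => ⟨_, h, by rw [map_smul, J_J]⟩
  · rintro ⟨W, hW, h⟩
    rwa [← map_smul, ← h, J_J]

/-- Even for `z = 0` the operator `H_V - zD` is defined only on `dom H_V ∩ H¹`, so the energy
estimate is what prevents the loss of kernel elements. -/
theorem pker_HV {b c : ℝ} (hc : 0 < c) {V : ℝ → ℝ} (hV : LocallyIntegrable V volume)
    (hlim : Tendsto (fun x : ℝ => ∫ s in x..(x + 1), |V s|) (cocompact ℝ) (𝓝 0)) :
    pker (HV b c V) = kerHV b c V 0 := by
  ext u
  rw [kerHV, mem_pker, mem_pker]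
  constructor
  · rintro ⟨h, h'⟩
    have hg : (u, HV b c V ⟨u, h⟩) ∈ schrodingerGraph b c V := by
      rw [← HV_graph]
      exact (HV b c V).mem_graph ⟨u, h⟩
    refine ⟨⟨h, mem_H1_of_mem_schrodingerGraph hc hV hlim hg⟩, ?_⟩
    rw [LinearPMap.sub_apply, LinearPMap.smul_apply, zero_smul, sub_zero]
    exact h'
  · rintro ⟨h, h'⟩
    rw [LinearPMap.sub_apply, LinearPMap.smul_apply, zero_smul, sub_zero] at h'
    exact ⟨h.1, h'⟩

theorem pker_calL (b c : ℝ) (V : ℝ → ℝ) : pker (calL b c V) = kerL b c V 0 := by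
  ext U
  rw [mem_kerL, zero_smul, mem_pker, ← calL_graph, LinearPMap.mem_graph_iff]
  constructor
  · rintro ⟨h, h'⟩
    exact ⟨⟨U, h⟩, rfl, h'⟩
  · rintro ⟨⟨U', hU⟩, rfl, h⟩
    exact ⟨hU, h⟩

end HamKrein

end

theorem mainTheorem4 (b c : ℝ) (hb : 0 < b) (hc : 0 < c) (V : ℝ → ℝ)
    (hV : LocallyIntegrable V volume)
    (hlim : Tendsto (fun x : ℝ => ∫ s in x..(x + 1), |V s|) (cocompact ℝ) (𝓝 0)) :
    (∀ z : ℂ, HamKrein.Coincide (HamKrein.kerHV b c V z) (HamKrein.kerL b c V z)) ∧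
    (∀ (z : ℂ) (n : ℕ),
      HamKrein.Coincide (HamKrein.kerHVPow b c V z n) (HamKrein.kerAPow b c V z n)) ∧
    (∀ z : ℂ, HamKrein.Coincide (HamKrein.genEigHV b c V z) (HamKrein.genEigA b c V z)) ∧
    HamKrein.Coincide (HamKrein.pker (HamKrein.HV b c V)) (HamKrein.pker (HamKrein.calL b c V)) := by
  refine ⟨fun z => (HamKrein.coincideH1_ker hc hV hlim z).coincide,
    fun z n => (HamKrein.coincideH1_kerPow hc hV hlim z n).coincide,
    fun z => (HamKrein.CoincideH1.iUnion
      fun n => HamKrein.coincideH1_kerPow hc hV hlim z n).coincide, ?_⟩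
  rw [HamKrein.pker_HV hc hV hlim, HamKrein.pker_calL]
  exact (HamKrein.coincideH1_ker hc hV hlim 0).coincide
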